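/- Let $A$ be a finite-dimensional quasi-Hopf algebra over a field $\Bbbk$ with coproduct $\Delta$, counit $\varepsilon:A\to\Bbbk$, antipode $S$, evaluation and coevaluation elements $\alpha,\beta\in A$, and coassociator $\Phi\in A^{\otimes 3}$. The axioms are that $\Delta,\varepsilon$ are algebra homomorphisms, $S$ is a linear unital algebra anti-homomorphism, $\Phi$ is invertible, and, for all $a\in A$, $$(\varepsilon\otimes\mathrm{id})\Delta=\mathrm{id}=(\mathrm{id}\otimes\varepsilon)\Delta,\qquad (\Delta\otimes\mathrm{id})(\Delta(a))\,\Phi=\Phi\,(\mathrm{id}\otimes\Delta)(\Delta(a)),\qquad (\mathrm{id}\otimes\varepsilon\otimes\mathrm{id})(\Phi)=1\otimes 1,$$ $$(\Delta\otimes\mathrm{id}\otimes\mathrm{id})(\Phi)\,(\mathrm{id}\otimes\mathrm{id}\otimes\Delta)(\Phi)=(\Phi\otimes1)\,(\mathrm{id}\otimes\Delta\otimes\mathrm{id})(\Phi)\,(1\otimes\Phi),$$ $$\textstyle\sum S(a')\alpha a''=\varepsilon(a)\alpha,\quad \sum a'\beta S(a'')=\varepsilon(a)\beta,\quad \sum S(\Phi_1)\alpha\Phi_2\beta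 S(\Phi_3)=1,\quad \sum(\Phi^{-1})_1\beta S((\Phi^{-1})_2)\alpha(\Phi^{-1})_3=1 .$$ Let $\mathrm{Rep}\,A$ be the monoidal category of finite-dimensional left $A$-modules: $A$ acts on $U\otimes V$ through $\Delta$ and on the unit object $\mathbf 1=\Bbbk$ through $\varepsilon$, the associator $U\otimes(V\otimes W)\to(U\otimes V)\otimes W$ is the action of $\Phi$, and the unit isomorphisms $\lambda,\varrho$ are those of vector spaces. It has left duals: $U^*$ is the dual space with $(a.\varphi)(u)=\varphi(S(a)u)$, with $\mathrm{ev}_U:U^*\otimes U\to\mathbf 1$, $\varphi\otimes u\mapsto\varphi(\alpha u)$, and $\mathrm{coev}_U:\mathbf 1\to U\otimes U^*$, $1\mapsto\sum_i\beta u_i\otimes u_i^*$. The coend $\mathcal L=\int^{U}U^*\otimes U$ in $\mathrm{Rep}\,A$ is the dual space $A^*$ with the coadjoint action $(a.f)(x)=\sum f(S(a')\,x\,a'')$ and the dinatural maps $\iota_U:U^*\otimes U\to\mathcal L$, $\iota_U(\varphi\otimes u)=(a\mapsto\varphi(a u))$. Its coproduct $\Delta_{\mathcal L}:\mathcal L\to\mathcal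 L\otimes\mathcal L$ is the unique morphism such that, for every $U$, $\Delta_{\mathcal L}\circ\iota_U$ equals $$U^*\otimes U\xrightarrow{\ \mathrm{id}\otimes(\mathrm{coev}_U\otimes\mathrm{id})\circ\lambda_U^{-1}\ }U^*\otimes((U\otimes U^*)\otimes U)\xrightarrow{\ \sim\ }(U^*\otimes U)\otimes(U^*\otimes U)\xrightarrow{\ \iota_U\otimes\iota_U\ }\mathcal L\otimes\mathcal L ,$$ and its unit is $\eta_{\mathcal L}=\big[\mathbf 1\xrightarrow{\mathrm{coev}_{\mathbf 1}}\mathbf 1\otimes\mathbf 1^*\xrightarrow{\sim}\mathbf 1^*\xrightarrow{\sim}\mathbf 1^*\otimes\mathbf 1\xrightarrow{\iota_{\mathbf 1}}\mathcal L\big]$. A linear form $\Lambda:\mathcal L\to\Bbbk$ is called a left (respectively right) cointegral of $\mathcal L$ if, as linear maps $\mathcal L\to\mathcal L$, $$\varrho\circ(\mathrm{id}\otimes\Lambda)\circ\Delta_{\mathcal L}=\eta_{\mathcal L}\circ\Lambda\qquad\big(\text{respectively }\ \lambda\circ(\Lambda\otimes\mathrm{id})\circ\Delta_{\mathcal L}=\eta_{\mathcal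 L}\circ\Lambda\big).$$ Let $c\in A$ be a left (respectively right) integral, that is, $ac=\varepsilon(a)c$ (respectively $ca=\varepsilon(a)c$) for all $a\in A$. Then $\langle-,c\rangle\in\mathcal L^*=A^{**}$, $f\mapsto f(c)$, is a left (respectively right) cointegral of $\mathcal L$. If $c$ is both a left and a right integral, then $\langle-,c\rangle$ is moreover a morphism $\mathcal L\to\mathbf 1$ of $\mathrm{Rep}\,A$, and it is a left and a right cointegral of $\mathcal L$ in the category $\mathrm{Rep}\,A$ (the equations above hold between morphisms of $\mathrm{Rep}\,A$). -/

import Mathlib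

open CategoryTheory MonoidalCategory Limits Opposite
open scoped TensorProduct

universe u

set_option linter.unusedSectionVars false
set_option linter.unusedSimpArgs false

/-- A quasi-Hopf algebra over a field `k` whose unit constraints are trivial.  The coassociator
is an invertible element of `A ⊗ (A ⊗ A)`. -/
class QuasiHopfAlgebra (k A : Type*) [Field k] [Ring A] [Algebra k A] where
  /-- the coproduct `Δ` -/
  comul : A →ₐ[k] A ⊗[k] A
  /-- the counit `ε` -/
  counit : A →ₐ[k] k
  /-- the antipode `S` -/
  antipode : A →ₗ[k] A
  /-- the coassociator `Φ` -/
  coassociator : (A ⊗[k] (A ⊗[k] A))ˣ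
  /-- the evaluation element -/
  alpha : A
  /-- the coevaluation element -/
  beta : A
  antipode_one : antipode 1 = 1
  antipode_mul : ∀ a b : A, antipode (a * b) = antipode b * antipode a
  counit_comul : ∀ a : A,
    Algebra.TensorProduct.lid k A
      (Algebra.TensorProduct.map counit (AlgHom.id k A) (comul a)) = a
  comul_counit : ∀ a : A,
    Algebra.TensorProduct.rid k k A
      (Algebra.TensorProduct.map (AlgHom.id k A) counit (comul a)) = a
  /-- `(Δ ⊗ id)(Δ a) · Φ = Φ · (id ⊗ Δ)(Δ a)` -/
  coassoc : ∀ a : A,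
    Algebra.TensorProduct.assoc k k k A A A
        (Algebra.TensorProduct.map comul (AlgHom.id k A) (comul a)) * (coassociator : A ⊗[k] (A ⊗[k] A)) =
      (coassociator : A ⊗[k] (A ⊗[k] A)) *
        Algebra.TensorProduct.map (AlgHom.id k A) comul (comul a)
  /-- `(id ⊗ ε ⊗ id)(Φ) = 1 ⊗ 1` -/
  coassociator_counital :
    Algebra.TensorProduct.map (AlgHom.id k A)
      ((Algebra.TensorProduct.lid k A).toAlgHom.comp
        (Algebra.TensorProduct.map counit (AlgHom.id k A)))
      (coassociator : A ⊗[k] (A ⊗[k] A)) = 1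
  /-- `(Δ ⊗ id ⊗ id)(Φ) · (id ⊗ id ⊗ Δ)(Φ) = (Φ ⊗ 1) · (id ⊗ Δ ⊗ id)(Φ) · (1 ⊗ Φ)`
  in `A ⊗ (A ⊗ (A ⊗ A))` -/
  cocycle :
    Algebra.TensorProduct.assoc k k k A A (A ⊗[k] A)
        (Algebra.TensorProduct.map comul (AlgHom.id k (A ⊗[k] A))
          (coassociator : A ⊗[k] (A ⊗[k] A))) *
      Algebra.TensorProduct.map (AlgHom.id k A)
        (Algebra.TensorProduct.map (AlgHom.id k A) comul)
        (coassociator : A ⊗[k] (A ⊗[k] A)) =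
    Algebra.TensorProduct.map (AlgHom.id k A)
        (Algebra.TensorProduct.map (AlgHom.id k A)
          (Algebra.TensorProduct.includeLeft : A →ₐ[k] A ⊗[k] A))
        (coassociator : A ⊗[k] (A ⊗[k] A)) *
      Algebra.TensorProduct.map (AlgHom.id k A)
        ((Algebra.TensorProduct.assoc k k k A A A).toAlgHom.comp
          (Algebra.TensorProduct.map comul (AlgHom.id k A)))
        (coassociator : A ⊗[k] (A ⊗[k] A)) *
      (1 : A) ⊗ₜ[k] (coassociator : A ⊗[k] (A ⊗[k] A))
  /-- `∑ S(a') α a'' = ε(a) α` -/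
  antipode_alpha : ∀ a : A,
    LinearMap.mul' k A
      (TensorProduct.map antipode (LinearMap.mulLeft k alpha) (comul a)) = counit a • alpha
  /-- `∑ a' β S(a'') = ε(a) β` -/
  beta_antipode : ∀ a : A,
    LinearMap.mul' k A
      (TensorProduct.map (LinearMap.mulRight k beta) antipode (comul a)) = counit a • beta
  /-- `∑ S(Φ₁) α Φ₂ β S(Φ₃) = 1` -/
  zigzag :
    LinearMap.mul' k A
      (TensorProduct.map antipode
        (LinearMap.mul' k A ∘ₗ
          TensorProduct.map (LinearMap.mulLeft k alpha) (LinearMap.mulLeft k beta ∘ₗ antipode))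
        (coassociator : A ⊗[k] (A ⊗[k] A))) = 1
  /-- `∑ (Φ⁻¹)₁ β S((Φ⁻¹)₂) α (Φ⁻¹)₃ = 1` -/
  zigzag_inv :
    LinearMap.mul' k A
      (TensorProduct.map (LinearMap.id : A →ₗ[k] A)
        (LinearMap.mul' k A ∘ₗ
          TensorProduct.map (LinearMap.mulLeft k beta ∘ₗ antipode) (LinearMap.mulLeft k alpha))
        ((coassociator⁻¹ : (A ⊗[k] (A ⊗[k] A))ˣ) : A ⊗[k] (A ⊗[k] A))) = 1

/-- `Rep A`: a finite-dimensional representation of the `k`-algebra `A`. -/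
structure FinRep (k A : Type u) [Field k] [Ring A] [Algebra k A] where
  /-- the underlying vector space -/
  V : Type u
  [addCommGroup : AddCommGroup V]
  [module : Module k V]
  [finite : FiniteDimensional k V]
  /-- the action of `A` -/
  ρ : A →ₐ[k] Module.End k V

namespace FinRep

attribute [instance] addCommGroup module finite

section Category

variable {k A : Type u} [Field k] [Ring A] [Algebra k A]

/-- Morphisms of `Rep A` are the `A`-linear maps. -/
@[ext]
structure Hom (X Y : FinRep k A) where
  /-- the underlying linear map -/
  lin : X.V →ₗ[k] Y.V
  comm : ∀ (a : A) (x : X.V), lin (X.ρ a x) = Y.ρ a (lin x)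

instance : Category (FinRep k A) where
  Hom X Y := Hom X Y
  id X := ⟨LinearMap.id, fun _ _ => rfl⟩
  comp f g := ⟨g.lin ∘ₗ f.lin, fun a x => by simp [f.comm, g.comm]⟩

@[ext]
theorem hom_ext {X Y : FinRep k A} {f g : X ⟶ Y} (h : f.lin = g.lin) : f = g := Hom.ext h

@[simp] theorem id_lin (X : FinRep k A) : Hom.lin (𝟙 X) = LinearMap.id := rfl

@[simp] theorem comp_lin {X Y Z : FinRep k A} (f : X ⟶ Y) (g : Y ⟶ Z) :
    (f ≫ g).lin = g.lin ∘ₗ f.lin := rfl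

/-- An `A`-linear bijection as an isomorphism of `Rep A`. -/
@[simps]
def mkIso {X Y : FinRep k A} (e : X.V ≃ₗ[k] Y.V)
    (h : ∀ (a : A) (x : X.V), e (X.ρ a x) = Y.ρ a (e x)) : X ≅ Y where
  hom := ⟨e.toLinearMap, h⟩
  inv := ⟨e.symm.toLinearMap, fun a y => by
    apply e.injective
    simp [h]⟩
  hom_inv_id := by ext x; simp
  inv_hom_id := by ext x; simp

end Category

section Tensor

variable {k : Type*} [Field k] {A B C U V W : Type*} [Ring A] [Algebra k A] [Ring B] [Algebra k B]
  [Ring C] [Algebra k C]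
  [AddCommGroup U] [Module k U] [AddCommGroup V] [Module k V] [AddCommGroup W] [Module k W]

/-- The action of `A ⊗ B` on `U ⊗ V`: `(a ⊗ b).(u ⊗ v) = a.u ⊗ b.v`. -/
noncomputable def act (f : A →ₐ[k] Module.End k U) (g : B →ₐ[k] Module.End k V) :
    A ⊗[k] B →ₐ[k] Module.End k (U ⊗[k] V) :=
  (Module.endTensorEndAlgHom (R := k) (S := k) (A := k) (M := U) (N := V)).comp
    (Algebra.TensorProduct.map f g)

@[simp] theorem act_tmul (f : A →ₐ[k] Module.End k U) (g : B →ₐ[k] Module.End k V) (a : A) (b : B) :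
    act f g (a ⊗ₜ b) = TensorProduct.map (f a) (g b) := rfl

theorem act_map {A' B' : Type*} [Ring A'] [Algebra k A'] [Ring B'] [Algebra k B']
    (f : A →ₐ[k] Module.End k U) (g : B →ₐ[k] Module.End k V)
    (h : A' →ₐ[k] A) (l : B' →ₐ[k] B) (x : A' ⊗[k] B') :
    act f g (Algebra.TensorProduct.map h l x) = act (f.comp h) (g.comp l) x := by
  induction x with
  | zero => simp
  | add x y hx hy => simp only [map_add, hx, hy, TensorProduct.add_tmul, LinearMap.add_apply]
  | tmul a b => simp

theorem act_assoc (f : A →ₐ[k] Module.End k U) (g : B →ₐ[k] Module.End k V)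
    (h : C →ₐ[k] Module.End k W) (x : (A ⊗[k] B) ⊗[k] C) (t : (U ⊗[k] V) ⊗[k] W) :
    TensorProduct.assoc k U V W (act (act f g) h x t) =
      act f (act g h) (Algebra.TensorProduct.assoc k k k A B C x) (TensorProduct.assoc k U V W t) := by
  induction x with
  | zero => simp
  | add x y hx hy => simp only [map_add, hx, hy, TensorProduct.add_tmul, LinearMap.add_apply]
  | tmul x c =>
    induction x with
    | zero => simp
    | add x y hx hy => simp only [map_add, hx, hy, TensorProduct.add_tmul, LinearMap.add_apply]
    | tmul a b =>
      induction t with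
      | zero => simp
      | add x y hx hy => simp only [map_add, hx, hy, TensorProduct.add_tmul, LinearMap.add_apply]
      | tmul t w =>
        induction t with
        | zero => simp
        | add x y hx hy => simp only [map_add, hx, hy, TensorProduct.add_tmul, LinearMap.add_apply]
        | tmul u v => simp

theorem act_natural {U' V' : Type*} [AddCommGroup U'] [Module k U'] [AddCommGroup V'] [Module k V']
    (f : A →ₐ[k] Module.End k U) (g : B →ₐ[k] Module.End k V)
    (f' : A →ₐ[k] Module.End k U') (g' : B →ₐ[k] Module.End k V')
    (p : U →ₗ[k] U') (q : V →ₗ[k] V') (hp : ∀ a x, p (f a x) = f' a (p x))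
    (hq : ∀ b y, q (g b y) = g' b (q y)) (x : A ⊗[k] B) (t : U ⊗[k] V) :
    TensorProduct.map p q (act f g x t) = act f' g' x (TensorProduct.map p q t) := by
  induction x with
  | zero => simp
  | add x y hx hy => simp only [map_add, hx, hy, TensorProduct.add_tmul, LinearMap.add_apply]
  | tmul a b =>
    induction t with
    | zero => simp
    | add x y hx hy => simp only [map_add, hx, hy, TensorProduct.add_tmul, LinearMap.add_apply]
    | tmul u v => simp [hp, hq]

end Tensor

section Unbundled

open QuasiHopfAlgebra

variable {k A : Type*} [Field k] [Ring A] [Algebra k A]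

theorem assoc_PhiOne (x : A ⊗[k] (A ⊗[k] A)) :
    Algebra.TensorProduct.map (AlgHom.id k A)
          (Algebra.TensorProduct.assoc k k k A A A).toAlgHom
        (Algebra.TensorProduct.assoc k k k A (A ⊗[k] A) A (x ⊗ₜ[k] (1 : A))) =
      Algebra.TensorProduct.map (AlgHom.id k A)
        (Algebra.TensorProduct.map (AlgHom.id k A)
          (Algebra.TensorProduct.includeLeft : A →ₐ[k] A ⊗[k] A)) x := by
  induction x with
  | zero => simp
  | add x y hx hy => simp only [map_add, hx, hy, TensorProduct.add_tmul]
  | tmul a x =>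
    induction x with
    | zero => simp
    | add x y hx hy => simp only [map_add, hx, hy, TensorProduct.add_tmul, TensorProduct.tmul_add]
    | tmul b c => simp

variable {U V W Z : Type*} [AddCommGroup U] [Module k U] [AddCommGroup V] [Module k V]
  [AddCommGroup W] [Module k W] [AddCommGroup Z] [Module k Z]

theorem assoc_pentagon (s : ((U ⊗[k] V) ⊗[k] W) ⊗[k] Z) :
    TensorProduct.assoc k U V (W ⊗[k] Z) (TensorProduct.assoc k (U ⊗[k] V) W Z s) =
      TensorProduct.map LinearMap.id (TensorProduct.assoc k V W Z).toLinearMap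
        (TensorProduct.assoc k U (V ⊗[k] W) Z
          (TensorProduct.map (TensorProduct.assoc k U V W).toLinearMap LinearMap.id s)) := by
  induction s with
  | zero => simp
  | add x y hx hy => simp only [map_add, hx, hy]
  | tmul s z =>
    induction s with
    | zero => simp
    | add x y hx hy => simp only [map_add, hx, hy, TensorProduct.add_tmul]
    | tmul s y =>
      induction s with
      | zero => simp
      | add x y hx hy => simp only [map_add, hx, hy, TensorProduct.add_tmul]
      | tmul w x => simp

variable (f : A →ₐ[k] Module.End k U) (g : A →ₐ[k] Module.End k V) (h : A →ₐ[k] Module.End k W)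
  (l : A →ₐ[k] Module.End k Z)

theorem act_rebracket (y : A ⊗[k] ((A ⊗[k] A) ⊗[k] A)) (s : U ⊗[k] ((V ⊗[k] W) ⊗[k] Z)) :
    TensorProduct.map LinearMap.id (TensorProduct.assoc k V W Z).toLinearMap
        (act f (act (act g h) l) y s) =
      act f (act g (act h l)) (Algebra.TensorProduct.map (AlgHom.id k A)
          (Algebra.TensorProduct.assoc k k k A A A).toAlgHom y)
        (TensorProduct.map LinearMap.id (TensorProduct.assoc k V W Z).toLinearMap s) := by
  rw [act_map, AlgHom.comp_id]
  have hq : ∀ (b : (A ⊗[k] A) ⊗[k] A) (t : (V ⊗[k] W) ⊗[k] Z),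
      (TensorProduct.assoc k V W Z).toLinearMap (act (act g h) l b t) =
      (act g (act h l)).comp (Algebra.TensorProduct.assoc k k k A A A).toAlgHom b
        ((TensorProduct.assoc k V W Z).toLinearMap t) := fun b t => act_assoc g h l b t
  exact act_natural f (act (act g h) l) f
    ((act g (act h l)).comp (Algebra.TensorProduct.assoc k k k A A A).toAlgHom)
    LinearMap.id (TensorProduct.assoc k V W Z).toLinearMap (fun _ _ => rfl) hq y s

variable [QuasiHopfAlgebra k A]

variable (k A) in
/-- The coassociator `Φ`. -/
abbrev Phi : A ⊗[k] (A ⊗[k] A) := (coassociator (k := k) (A := A) : (A ⊗[k] (A ⊗[k] A))ˣ)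

variable (k A) in
/-- The inverse `Φ⁻¹` of the coassociator. -/
abbrev PhiInv : A ⊗[k] (A ⊗[k] A) := ((coassociator (k := k) (A := A))⁻¹ : (A ⊗[k] (A ⊗[k] A))ˣ)

/-- The action of `A` on a tensor product of representations, `a` acting by `Δ(a)`. -/
noncomputable abbrev tensAct : A →ₐ[k] Module.End k (U ⊗[k] V) := (act f g).comp comul

/-- The action of `A` on the trivial representation `k`, `a` acting by `ε(a)`. -/
noncomputable abbrev unitAct : A →ₐ[k] Module.End k k :=
  (Algebra.ofId k (Module.End k k)).comp counit

theorem act_Phi_PhiInv (t : U ⊗[k] (V ⊗[k] W)) :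
    act f (act g h) (Phi k A) (act f (act g h) (PhiInv k A) t) = t := by
  rw [← Module.End.mul_apply, ← map_mul]
  simp

theorem act_PhiInv_Phi (t : U ⊗[k] (V ⊗[k] W)) :
    act f (act g h) (PhiInv k A) (act f (act g h) (Phi k A) t) = t := by
  rw [← Module.End.mul_apply, ← map_mul]
  simp

/-- The associativity isomorphism `U ⊗ (V ⊗ W) → (U ⊗ V) ⊗ W`, `u ⊗ v ⊗ w ↦ Φ.(u ⊗ v ⊗ w)`. -/
noncomputable def assocEquiv : (U ⊗[k] (V ⊗[k] W)) ≃ₗ[k] ((U ⊗[k] V) ⊗[k] W) :=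
  LinearEquiv.trans
    { act f (act g h) (Phi k A) with
      invFun := act f (act g h) (PhiInv k A)
      left_inv := act_PhiInv_Phi f g h
      right_inv := act_Phi_PhiInv f g h }
    (TensorProduct.assoc k U V W).symm

theorem assoc_assocEquiv (t : U ⊗[k] (V ⊗[k] W)) :
    TensorProduct.assoc k U V W (assocEquiv f g h t) = act f (act g h) (Phi k A) t :=
  (TensorProduct.assoc k U V W).apply_symm_apply _

theorem assoc_comp_assocEquiv :
    (TensorProduct.assoc k U V W).toLinearMap ∘ₗ (assocEquiv f g h).toLinearMap =
      act f (act g h) (Phi k A) :=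
  LinearMap.ext fun t => assoc_assocEquiv f g h t

theorem assocEquiv_symm_apply (t : (U ⊗[k] V) ⊗[k] W) :
    (assocEquiv f g h).symm t = act f (act g h) (PhiInv k A) (TensorProduct.assoc k U V W t) := rfl

theorem assocEquiv_comm (a : A) (t : U ⊗[k] (V ⊗[k] W)) :
    assocEquiv f g h (tensAct f (tensAct g h) a t) =
      tensAct (tensAct f g) h a (assocEquiv f g h t) := by
  apply (TensorProduct.assoc k U V W).injective
  have h1 : tensAct f (tensAct g h) a =
      act f (act g h) (Algebra.TensorProduct.map (AlgHom.id k A) comul (comul a)) := by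
    rw [act_map]; rfl
  have h2 : tensAct (tensAct f g) h a = act (act f g) h
      (Algebra.TensorProduct.map comul (AlgHom.id k A) (comul a)) := by
    rw [act_map]; rfl
  rw [h1, h2, act_assoc, assoc_assocEquiv, assoc_assocEquiv,
    ← Module.End.mul_apply, ← Module.End.mul_apply, ← map_mul, ← map_mul, coassoc]

theorem lid_comm (a : A) (t : k ⊗[k] U) :
    TensorProduct.lid k U (tensAct unitAct f a t) = f a (TensorProduct.lid k U t) := by
  have key : ∀ (x : A ⊗[k] A) (t : k ⊗[k] U),
      TensorProduct.lid k U (act unitAct f x t) =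
      f (Algebra.TensorProduct.lid k A
        (Algebra.TensorProduct.map counit (AlgHom.id k A) x)) (TensorProduct.lid k U t) := by
    intro x t
    induction x with
    | zero => simp
    | add x y hx hy => simp only [map_add, hx, hy, LinearMap.add_apply]
    | tmul a b =>
      induction t with
      | zero => simp
      | add x y hx hy => simp only [map_add, hx, hy]
      | tmul u v => simp [smul_smul, mul_comm]
  have := key (comul a) t
  rwa [counit_comul] at this

theorem rid_comm (a : A) (t : U ⊗[k] k) :
    TensorProduct.rid k U (tensAct f unitAct a t) = f a (TensorProduct.rid k U t) := by
  have key : ∀ (x : A ⊗[k] A) (t : U ⊗[k] k),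
      TensorProduct.rid k U (act f unitAct x t) =
      f (Algebra.TensorProduct.rid k k A
        (Algebra.TensorProduct.map (AlgHom.id k A) counit x)) (TensorProduct.rid k U t) := by
    intro x t
    induction x with
    | zero => simp
    | add x y hx hy => simp only [map_add, hx, hy, LinearMap.add_apply]
    | tmul a b =>
      induction t with
      | zero => simp
      | add x y hx hy => simp only [map_add, hx, hy]
      | tmul u v => simp [smul_smul, mul_comm]
  have := key (comul a) t
  rwa [comul_counit] at this

theorem triangleAux (t : U ⊗[k] (k ⊗[k] V)) :
    TensorProduct.map (TensorProduct.rid k U).toLinearMap LinearMap.id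
        (assocEquiv f unitAct g t) =
      TensorProduct.map LinearMap.id (TensorProduct.lid k V).toLinearMap t := by
  have key : ∀ (x : A ⊗[k] (A ⊗[k] A)) (t : U ⊗[k] (k ⊗[k] V)),
      TensorProduct.map LinearMap.id (TensorProduct.lid k V).toLinearMap
        (act f (act unitAct g) x t) = act f g (Algebra.TensorProduct.map (AlgHom.id k A)
      ((Algebra.TensorProduct.lid k A).toAlgHom.comp
        (Algebra.TensorProduct.map counit (AlgHom.id k A))) x)
        (TensorProduct.map LinearMap.id (TensorProduct.lid k V).toLinearMap t) := by
    intro x t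
    induction x with
    | zero => simp
    | add x y hx hy => simp only [map_add, hx, hy, LinearMap.add_apply]
    | tmul a x =>
      induction x with
      | zero => simp
      | add x y hx hy => simp only [map_add, hx, hy, LinearMap.add_apply, TensorProduct.tmul_add]
      | tmul b c =>
        induction t with
        | zero => simp
        | add x y hx hy => simp only [map_add, hx, hy]
        | tmul u t =>
          induction t with
          | zero => simp
          | add x y hx hy => simp only [map_add, hx, hy, TensorProduct.tmul_add]
          | tmul r v => simp [smul_smul, mul_comm]
  have h3 : ∀ s : (U ⊗[k] k) ⊗[k] V,
      TensorProduct.map (TensorProduct.rid k U).toLinearMap LinearMap.id s =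
      TensorProduct.map LinearMap.id (TensorProduct.lid k V).toLinearMap
        (TensorProduct.assoc k U k V s) := by
    intro s
    induction s with
    | zero => simp
    | add x y hx hy => simp only [map_add, hx, hy]
    | tmul s v =>
      induction s with
      | zero => simp
      | add x y hx hy => simp only [map_add, hx, hy, TensorProduct.add_tmul]
      | tmul u r => simp [TensorProduct.smul_tmul]
  rw [h3, assoc_assocEquiv, key, coassociator_counital]
  simp

set_option maxHeartbeats 400000 in
theorem pentagonAux (t : U ⊗[k] (V ⊗[k] (W ⊗[k] Z))) :
    TensorProduct.map (assocEquiv f g h).toLinearMap LinearMap.id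
      (assocEquiv f (tensAct g h) l
        (TensorProduct.map LinearMap.id (assocEquiv g h l).toLinearMap t)) =
    assocEquiv (tensAct f g) h l (assocEquiv f g (tensAct h l) t) := by
  apply (TensorProduct.assoc k (U ⊗[k] V) W Z).injective
  apply (TensorProduct.assoc k U V (W ⊗[k] Z)).injective
  have hR : TensorProduct.assoc k U V (W ⊗[k] Z) (TensorProduct.assoc k (U ⊗[k] V) W Z
        (assocEquiv (tensAct f g) h l (assocEquiv f g (tensAct h l) t))) =
      act f (act g (act h l)) (Algebra.TensorProduct.assoc k k k A A (A ⊗[k] A)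
        (Algebra.TensorProduct.map comul (AlgHom.id k (A ⊗[k] A)) (Phi k A)) *
          Algebra.TensorProduct.map (AlgHom.id k A)
        (Algebra.TensorProduct.map (AlgHom.id k A) comul) (Phi k A)) t := by
    rw [map_mul, Module.End.mul_apply, assoc_assocEquiv]
    have h1 : act (tensAct f g) (act h l) (Phi k A) = act (act f g) (act h l)
        (Algebra.TensorProduct.map comul (AlgHom.id k (A ⊗[k] A)) (Phi k A)) := by
      rw [act_map, AlgHom.comp_id]
    have h2 : act f (act g (tensAct h l)) (Phi k A) =
        act f (act g (act h l)) (Algebra.TensorProduct.map (AlgHom.id k A)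
        (Algebra.TensorProduct.map (AlgHom.id k A) comul) (Phi k A)) := by
      rw [act_map]
      have : (act g (act h l)).comp (Algebra.TensorProduct.map (AlgHom.id k A) comul) =
          act g (tensAct h l) := by
        refine AlgHom.ext fun x => ?_
        rw [AlgHom.comp_apply, act_map, AlgHom.comp_id]
      rw [this, AlgHom.comp_id]
    rw [h1, act_assoc, assoc_assocEquiv, h2]
  rw [hR, cocycle, map_mul, map_mul, Module.End.mul_apply, Module.End.mul_apply]
  set b := (TensorProduct.map (LinearMap.id : U →ₗ[k] U)
    (TensorProduct.assoc k V W Z).toLinearMap) with hb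
  have s1 : b (TensorProduct.map LinearMap.id (assocEquiv g h l).toLinearMap t) =
      act f (act g (act h l)) ((1 : A) ⊗ₜ Phi k A) t := by
    rw [act_tmul, map_one, hb, ← LinearMap.comp_apply, ← TensorProduct.map_comp]
    rw [assoc_comp_assocEquiv, LinearMap.id_comp]
    rfl
  have s2 : ∀ s, b (TensorProduct.assoc k U (V ⊗[k] W) Z (assocEquiv f (tensAct g h) l s)) =
      act f (act g (act h l)) (Algebra.TensorProduct.map (AlgHom.id k A)
        ((Algebra.TensorProduct.assoc k k k A A A).toAlgHom.comp
          (Algebra.TensorProduct.map comul (AlgHom.id k A))) (Phi k A)) (b s) := by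
    intro s
    rw [assoc_assocEquiv, act_map, AlgHom.comp_id]
    have hq : ∀ (y : A ⊗[k] A) (t : (V ⊗[k] W) ⊗[k] Z),
        (TensorProduct.assoc k V W Z).toLinearMap (act (tensAct g h) l y t) =
        (act g (act h l)).comp ((Algebra.TensorProduct.assoc k k k A A A).toAlgHom.comp
          (Algebra.TensorProduct.map comul (AlgHom.id k A))) y
          ((TensorProduct.assoc k V W Z).toLinearMap t) := by
      intro y t
      have := act_assoc g h l (Algebra.TensorProduct.map comul (AlgHom.id k A) y) t
      rw [act_map, AlgHom.comp_id] at this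
      exact this
    exact act_natural f (act (tensAct g h) l) f
      ((act g (act h l)).comp ((Algebra.TensorProduct.assoc k k k A A A).toAlgHom.comp
          (Algebra.TensorProduct.map comul (AlgHom.id k A))))
      LinearMap.id (TensorProduct.assoc k V W Z).toLinearMap (fun _ _ => rfl) hq _ s
  have s3 : ∀ s, TensorProduct.assoc k U V (W ⊗[k] Z)
      (TensorProduct.assoc k (U ⊗[k] V) W Z
        (TensorProduct.map (assocEquiv f g h).toLinearMap LinearMap.id s)) =
      act f (act g (act h l)) (Algebra.TensorProduct.map (AlgHom.id k A)
        (Algebra.TensorProduct.map (AlgHom.id k A)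
          (Algebra.TensorProduct.includeLeft : A →ₐ[k] A ⊗[k] A)) (Phi k A))
        (b (TensorProduct.assoc k U (V ⊗[k] W) Z s)) := by
    intro s
    rw [assoc_pentagon, ← assoc_PhiOne, hb, ← act_rebracket, ← act_assoc]
    rw [act_tmul, map_one, ← LinearMap.comp_apply (TensorProduct.map _ LinearMap.id),
      ← TensorProduct.map_comp, assoc_comp_assocEquiv, LinearMap.id_comp]
    rfl
  rw [s3, s2, s1]

/-- The action of `A` on the dual space: `(a.φ)(u) = φ(S(a).u)`. -/
noncomputable def dualAct : A →ₐ[k] Module.End k (Module.Dual k U) :=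
  AlgHom.ofLinearMap
    ((Module.Dual.transpose : Module.End k U →ₗ[k] _) ∘ₗ f.toLinearMap ∘ₗ antipode)
    (by
      ext φ u
      simp [antipode_one, Module.Dual.transpose_apply])
    (by
      intro a b
      ext φ u
      simp [antipode_mul, Module.Dual.transpose_apply])

theorem dualAct_apply (a : A) (φ : Module.Dual k U) (u : U) :
    dualAct f a φ u = φ (f (antipode (k := k) a) u) := rfl

/-- The evaluation `φ ⊗ u ↦ φ(α.u)`. -/
noncomputable def evLin : Module.Dual k U ⊗[k] U →ₗ[k] k :=
  contractLeft k U ∘ₗ TensorProduct.map LinearMap.id (f (alpha k))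

@[simp] theorem evLin_tmul (φ : Module.Dual k U) (u : U) :
    evLin f (φ ⊗ₜ u) = φ (f (alpha k) u) := rfl

/-- The coevaluation `1 ↦ ∑ᵢ β.uᵢ ⊗ uᵢ*`. -/
noncomputable def coevLin [FiniteDimensional k U] : k →ₗ[k] U ⊗[k] Module.Dual k U :=
  TensorProduct.map (f (beta k)) LinearMap.id ∘ₗ coevaluation k U

theorem evLin_act (x : A ⊗[k] A) (φ : Module.Dual k U) (u : U) :
    evLin f (act (dualAct f) f x (φ ⊗ₜ u)) =
      φ (f (LinearMap.mul' k A
      (TensorProduct.map (antipode (k := k)) (LinearMap.mulLeft k (alpha k)) x)) u) := by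
  induction x with
  | zero => simp
  | add x y hx hy => simp only [map_add, hx, hy, LinearMap.add_apply]
  | tmul a b => simp [dualAct_apply]

theorem evLin_comm (a : A) (t : Module.Dual k U ⊗[k] U) :
    evLin f (tensAct (dualAct f) f a t) = unitAct a (evLin f t) := by
  induction t with
  | zero => simp
  | add x y hx hy => simp only [map_add, hx, hy]
  | tmul φ u =>
    have := evLin_act f (comul a) φ u
    rw [antipode_alpha] at this
    refine this.trans ?_
    simp

/-- The canonical map `U ⊗ U* → End U`. -/
noncomputable def toEnd : U ⊗[k] Module.Dual k U →ₗ[k] Module.End k U :=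
  dualTensorHom k U U ∘ₗ (TensorProduct.comm k U (Module.Dual k U)).toLinearMap

theorem toEnd_tmul (u : U) (φ : Module.Dual k U) (v : U) :
    toEnd (u ⊗ₜ[k] φ) v = φ v • u := rfl

theorem pentagonHom (t : ((U ⊗[k] V) ⊗[k] W) ⊗[k] Z) :
    TensorProduct.map LinearMap.id (assocEquiv g h l).symm.toLinearMap
      ((assocEquiv f (tensAct g h) l).symm
        (TensorProduct.map (assocEquiv f g h).symm.toLinearMap LinearMap.id t)) =
    (assocEquiv f g (tensAct h l)).symm ((assocEquiv (tensAct f g) h l).symm t) := by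
  obtain ⟨t, rfl⟩ := (assocEquiv (tensAct f g) h l).surjective t
  obtain ⟨s, rfl⟩ := (assocEquiv f g (tensAct h l)).surjective t
  rw [LinearEquiv.symm_apply_apply, LinearEquiv.symm_apply_apply, ← pentagonAux,
    ← LinearMap.comp_apply (TensorProduct.map (assocEquiv f g h).symm.toLinearMap _),
    ← TensorProduct.map_comp, LinearEquiv.symm_comp, LinearMap.id_comp, TensorProduct.map_id,
    LinearMap.id_apply, LinearEquiv.symm_apply_apply,
    ← LinearMap.comp_apply (TensorProduct.map _ _),
    ← TensorProduct.map_comp, LinearEquiv.symm_comp, LinearMap.id_comp, TensorProduct.map_id,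
    LinearMap.id_apply]

theorem triangleHom (t : (U ⊗[k] k) ⊗[k] V) :
    TensorProduct.map LinearMap.id (TensorProduct.lid k V).toLinearMap
        ((assocEquiv f unitAct g).symm t) =
      TensorProduct.map (TensorProduct.rid k U).toLinearMap LinearMap.id t := by
  rw [← triangleAux f g, LinearEquiv.apply_symm_apply]

variable [FiniteDimensional k U]

theorem toEnd_map (p q : Module.End k U) (t : U ⊗[k] Module.Dual k U) :
    toEnd (TensorProduct.map p (Module.Dual.transpose (R := k) q) t) = p ∘ₗ toEnd t ∘ₗ q := by
  induction t with
  | zero => simp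
  | add x y hx hy => simp only [map_add, hx, hy, LinearMap.comp_add, LinearMap.add_comp]
  | tmul u φ =>
    ext v
    simp [toEnd_tmul, Module.Dual.transpose_apply]

theorem toEnd_coevaluation (t : k) : toEnd (coevaluation k U t) = t • LinearMap.id := by
  have : t = t • (1 : k) := by simp
  conv_lhs => rw [this, map_smul, map_smul]
  congr 1
  ext v
  rw [coevaluation_apply_one]
  simp only [map_sum, LinearMap.sum_apply, toEnd_tmul, LinearMap.id_apply]
  exact (Module.Basis.ofVectorSpace k U).sum_repr v

theorem toEnd_injective : Function.Injective (toEnd (k := k) (U := U)) := by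
  have h : Function.Injective (dualTensorHom k U U) := (dualTensorHomEquiv k U U).injective
  exact h.comp (TensorProduct.comm k U (Module.Dual k U)).injective

theorem transpose_id : Module.Dual.transpose (R := k) (LinearMap.id : U →ₗ[k] U) = LinearMap.id :=
  rfl

theorem toEnd_coevLin (t : k) : toEnd (coevLin f t) = t • f (beta k) := by
  rw [coevLin, ← transpose_id, LinearMap.comp_apply, toEnd_map, toEnd_coevaluation]
  ext v
  simp

theorem toEnd_act (x : A ⊗[k] A) (t : U ⊗[k] Module.Dual k U) (s : k)
    (ht : toEnd t = s • f (beta k)) :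
    toEnd (act f (dualAct f) x t) = s • f (LinearMap.mul' k A
      (TensorProduct.map (LinearMap.mulRight k (beta k)) (antipode (k := k)) x)) := by
  induction x with
  | zero => simp
  | add x y hx hy => simp only [map_add, hx, hy, LinearMap.add_apply, smul_add]
  | tmul a b =>
    have h := toEnd_map (f a) (f (antipode (k := k) b)) t
    rw [ht] at h
    refine h.trans ?_
    ext v
    simp

theorem coevLin_comm (a : A) (t : k) :
    coevLin f (unitAct a t) = tensAct f (dualAct f) a (coevLin f t) := by
  apply toEnd_injective
  have := toEnd_act f (comul a) _ t (toEnd_coevLin f t)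
  rw [beta_antipode] at this
  refine Eq.trans ?_ this.symm
  rw [toEnd_coevLin]
  simp [smul_smul, mul_comm]

theorem zigzag_left (u : U) :
    TensorProduct.map LinearMap.id (evLin f) ((assocEquiv f (dualAct f) f).symm
      (TensorProduct.map (coevLin f) LinearMap.id ((1 : k) ⊗ₜ[k] u))) = u ⊗ₜ (1 : k) := by
  have key : ∀ (a b c : A) (t : U ⊗[k] Module.Dual k U),
      TensorProduct.rid k U (TensorProduct.map LinearMap.id (evLin f)
        (act f (act (dualAct f) f) (a ⊗ₜ (b ⊗ₜ c)) (TensorProduct.assoc k U _ U (t ⊗ₜ[k] u)))) =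
      f a (toEnd t (f (antipode (k := k) b * (alpha k * c)) u)) := by
    intro a b c t
    induction t with
    | zero => simp
    | add x y hx hy => simp only [map_add, hx, hy, LinearMap.add_apply, TensorProduct.add_tmul]
    | tmul v φ => simp [toEnd_tmul, dualAct_apply]
  have key2 : ∀ x : A ⊗[k] (A ⊗[k] A),
      TensorProduct.rid k U (TensorProduct.map LinearMap.id (evLin f)
        (act f (act (dualAct f) f) x (TensorProduct.assoc k U _ U (coevLin f 1 ⊗ₜ[k] u)))) =
      f (LinearMap.mul' k A
        (TensorProduct.map (LinearMap.id : A →ₗ[k] A)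
          (LinearMap.mul' k A ∘ₗ TensorProduct.map
            (LinearMap.mulLeft k (beta k) ∘ₗ antipode (k := k)) (LinearMap.mulLeft k (alpha k))) x))
        u := by
    intro x
    induction x with
    | zero => simp
    | add x y hx hy => simp only [map_add, hx, hy, LinearMap.add_apply]
    | tmul a x =>
      induction x with
      | zero => simp
      | add x y hx hy =>
        simp only [map_add, hx, hy, LinearMap.add_apply, TensorProduct.tmul_add]
      | tmul b c =>
        rw [key, toEnd_coevLin]
        simp
  apply (TensorProduct.rid k U).injective
  rw [TensorProduct.map_tmul, assocEquiv_symm_apply]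
  refine (key2 (PhiInv k A)).trans ?_
  rw [zigzag_inv]
  simp

theorem zigzag_right (φ : Module.Dual k U) :
    TensorProduct.map (evLin f) LinearMap.id ((assocEquiv (dualAct f) f (dualAct f))
      (TensorProduct.map LinearMap.id (coevLin f) (φ ⊗ₜ[k] (1 : k)))) = (1 : k) ⊗ₜ φ := by
  have key : ∀ (a b c : A) (t : U ⊗[k] Module.Dual k U) (v : U),
      TensorProduct.lid k (Module.Dual k U) (TensorProduct.map (evLin f) LinearMap.id
        ((TensorProduct.assoc k _ U _).symm
          (act (dualAct f) (act f (dualAct f)) (a ⊗ₜ (b ⊗ₜ c)) (φ ⊗ₜ t)))) v =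
      φ (f (antipode (k := k) a * (alpha k * b)) (toEnd t (f (antipode (k := k) c) v))) := by
    intro a b c t v
    induction t with
    | zero => simp
    | add x y hx hy => simp only [map_add, hx, hy, LinearMap.add_apply, TensorProduct.tmul_add]
    | tmul v ψ => simp [toEnd_tmul, dualAct_apply, mul_comm]
  have key2 : ∀ (x : A ⊗[k] (A ⊗[k] A)) (v : U),
      TensorProduct.lid k (Module.Dual k U) (TensorProduct.map (evLin f) LinearMap.id
        ((TensorProduct.assoc k _ U _).symm
          (act (dualAct f) (act f (dualAct f)) x (φ ⊗ₜ coevLin f 1)))) v =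
      φ (f (LinearMap.mul' k A (TensorProduct.map (antipode (k := k))
        (LinearMap.mul' k A ∘ₗ TensorProduct.map (LinearMap.mulLeft k (alpha k))
            (LinearMap.mulLeft k (beta k) ∘ₗ antipode (k := k))) x)) v) := by
    intro x v
    induction x with
    | zero => simp
    | add x y hx hy => simp only [map_add, hx, hy, LinearMap.add_apply]
    | tmul a x =>
      induction x with
      | zero => simp
      | add x y hx hy =>
        simp only [map_add, hx, hy, LinearMap.add_apply, TensorProduct.tmul_add]
      | tmul b c =>
        rw [key, toEnd_coevLin]
        simp
  apply (TensorProduct.lid k (Module.Dual k U)).injective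
  apply LinearMap.ext
  intro v
  rw [TensorProduct.map_tmul]
  refine (key2 (Phi k A) v).trans ?_
  rw [zigzag]
  simp

theorem zigzagLeftHom (t : k ⊗[k] U) :
    TensorProduct.map LinearMap.id (evLin f) ((assocEquiv f (dualAct f) f).symm
      (TensorProduct.map (coevLin f) LinearMap.id t)) =
    (TensorProduct.rid k U).symm (TensorProduct.lid k U t) := by
  obtain ⟨u, rfl⟩ := (TensorProduct.lid k U).symm.surjective t
  rw [LinearEquiv.apply_symm_apply, TensorProduct.lid_symm_apply, zigzag_left,
    TensorProduct.rid_symm_apply]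

theorem zigzagRightHom (t : Module.Dual k U ⊗[k] k) :
    TensorProduct.map (evLin f) LinearMap.id ((assocEquiv (dualAct f) f (dualAct f))
      (TensorProduct.map LinearMap.id (coevLin f) t)) =
    (TensorProduct.lid k _).symm (TensorProduct.rid k _ t) := by
  obtain ⟨u, rfl⟩ := (TensorProduct.rid k _).symm.surjective t
  rw [LinearEquiv.apply_symm_apply, TensorProduct.rid_symm_apply, zigzag_right,
    TensorProduct.lid_symm_apply]

end Unbundled

section Monoidal

open QuasiHopfAlgebra

variable {k A : Type u} [Field k] [Ring A] [Algebra k A] [QuasiHopfAlgebra k A]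

/-- `Rep A` is a monoidal category: the tensor product and its unit are those of vector spaces,
with `A` acting through `Δ` and `ε`, the unit isomorphisms are those of vector spaces, and the
associativity isomorphism `X ⊗ (Y ⊗ Z) → (X ⊗ Y) ⊗ Z` is the action of `Φ`. -/
noncomputable instance : MonoidalCategoryStruct (FinRep k A) where
  tensorObj X Y := ⟨X.V ⊗[k] Y.V, tensAct X.ρ Y.ρ⟩
  whiskerLeft _ _ _ p := ⟨TensorProduct.map LinearMap.id p.lin, fun a t =>
    act_natural _ _ _ _ _ _ (fun _ _ => rfl) p.comm (comul a) t⟩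
  whiskerRight p _ := ⟨TensorProduct.map p.lin LinearMap.id, fun a t =>
    act_natural _ _ _ _ _ _ p.comm (fun _ _ => rfl) (comul a) t⟩
  tensorHom p q := ⟨TensorProduct.map p.lin q.lin, fun a t =>
    act_natural _ _ _ _ _ _ p.comm q.comm (comul a) t⟩
  tensorUnit := ⟨k, unitAct⟩
  associator X Y Z := (mkIso (assocEquiv X.ρ Y.ρ Z.ρ) (assocEquiv_comm X.ρ Y.ρ Z.ρ)).symm
  leftUnitor X := mkIso (TensorProduct.lid k X.V) (lid_comm X.ρ)
  rightUnitor X := mkIso (TensorProduct.rid k X.V) (rid_comm X.ρ)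

theorem assocEquiv_natural {X X' Y Y' Z Z' : FinRep k A} (p : X ⟶ X') (q : Y ⟶ Y') (r : Z ⟶ Z')
    (t : X.V ⊗[k] (Y.V ⊗[k] Z.V)) :
    TensorProduct.map (TensorProduct.map p.lin q.lin) r.lin (assocEquiv X.ρ Y.ρ Z.ρ t) =
      assocEquiv X'.ρ Y'.ρ Z'.ρ (TensorProduct.map p.lin (TensorProduct.map q.lin r.lin) t) := by
  apply (TensorProduct.assoc k _ _ _).injective
  rw [assoc_assocEquiv, ← act_natural X.ρ (act Y.ρ Z.ρ) X'.ρ (act Y'.ρ Z'.ρ) p.lin _ p.comm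
    (fun b s => act_natural _ _ _ _ _ _ q.comm r.comm b s), ← assoc_assocEquiv]
  generalize assocEquiv X.ρ Y.ρ Z.ρ t = s
  induction s with
  | zero => simp
  | add x y hx hy => simp only [map_add, hx, hy]
  | tmul s z =>
    induction s with
    | zero => simp
    | add x y hx hy => simp only [map_add, hx, hy, TensorProduct.add_tmul]
    | tmul x y => simp

theorem assocEquiv_symm_natural {X X' Y Y' Z Z' : FinRep k A} (p : X ⟶ X') (q : Y ⟶ Y')
    (r : Z ⟶ Z') (t : (X.V ⊗[k] Y.V) ⊗[k] Z.V) :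
    (assocEquiv X'.ρ Y'.ρ Z'.ρ).symm (TensorProduct.map (TensorProduct.map p.lin q.lin) r.lin t) =
      TensorProduct.map p.lin (TensorProduct.map q.lin r.lin)
        ((assocEquiv X.ρ Y.ρ Z.ρ).symm t) := by
  obtain ⟨s, rfl⟩ := (assocEquiv X.ρ Y.ρ Z.ρ).surjective t
  rw [assocEquiv_natural, LinearEquiv.symm_apply_apply, LinearEquiv.symm_apply_apply]

noncomputable instance : MonoidalCategory (FinRep k A) where
  tensorHom_def p q := hom_ext <| by
    change TensorProduct.map p.lin q.lin =
      TensorProduct.map LinearMap.id q.lin ∘ₗ TensorProduct.map p.lin LinearMap.id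
    rw [← TensorProduct.map_comp, LinearMap.id_comp, LinearMap.comp_id]
  id_tensorHom_id X Y := hom_ext TensorProduct.map_id
  tensorHom_comp_tensorHom p q r s := hom_ext (TensorProduct.map_comp _ _ _ _).symm
  whiskerLeft_id X Y := hom_ext TensorProduct.map_id
  id_whiskerRight X Y := hom_ext TensorProduct.map_id
  associator_naturality p q r := hom_ext (LinearMap.ext fun t => assocEquiv_symm_natural p q r t)
  leftUnitor_naturality {X Y} p := hom_ext <| TensorProduct.ext' fun r x => by
    change TensorProduct.lid k Y.V (r ⊗ₜ p.lin x) = p.lin (TensorProduct.lid k X.V (r ⊗ₜ x))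
    simp
  rightUnitor_naturality {X Y} p := hom_ext <| TensorProduct.ext' fun x r => by
    change TensorProduct.rid k Y.V (p.lin x ⊗ₜ r) = p.lin (TensorProduct.rid k X.V (x ⊗ₜ r))
    simp
  pentagon W X Y Z := hom_ext (LinearMap.ext fun t => pentagonHom W.ρ X.ρ Y.ρ Z.ρ t)
  triangle X Y := hom_ext (LinearMap.ext fun t => triangleHom X.ρ Y.ρ t)

/-- The left dual `X*`, `(a.φ)(x) = φ(S(a).x)`. -/
noncomputable def dual (X : FinRep k A) : FinRep k A := ⟨Module.Dual k X.V, dualAct X.ρ⟩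

/-- The evaluation `X* ⊗ X → 1`, `φ ⊗ x ↦ φ(α.x)`, and the coevaluation `1 → X ⊗ X*`,
`1 ↦ ∑ᵢ β.xᵢ ⊗ xᵢ*`. -/
noncomputable instance (X : FinRep k A) : ExactPairing X (dual X) where
  coevaluation' := ⟨coevLin X.ρ, coevLin_comm X.ρ⟩
  evaluation' := ⟨evLin X.ρ, evLin_comm X.ρ⟩
  coevaluation_evaluation' := hom_ext (LinearMap.ext fun t => zigzagRightHom X.ρ t)
  evaluation_coevaluation' := hom_ext (LinearMap.ext fun t => zigzagLeftHom X.ρ t)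

/-- The left dual `X*`, with `X* ⊗ X → 1` and `1 → X ⊗ X*`, is written `Xᘁ` in Mathlib. -/
noncomputable instance : RightRigidCategory (FinRep k A) where
  rightDual X := ⟨dual X⟩

theorem associator_inv_lin (X Y Z : FinRep k A) (t : X.V ⊗[k] (Y.V ⊗[k] Z.V)) :
    (α_ X Y Z).inv.lin t =
      (TensorProduct.assoc k X.V Y.V Z.V).symm (act X.ρ (act Y.ρ Z.ρ) (Phi k A) t) := rfl

theorem evaluation_lin (X : FinRep k A) (φ : Module.Dual k X.V) (x : X.V) :
    (ε_ X Xᘁ).lin (φ ⊗ₜ[k] x) = φ (X.ρ (QuasiHopfAlgebra.alpha k) x) := rfl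

end Monoidal
end FinRep

section Coend

variable {C : Type*} [Category* C] [MonoidalCategory C] [RightRigidCategory C]

variable (C) in
/-- Left duals `U*`, with `U* ⊗ U → 1` and `1 → U ⊗ U*`, are written `Uᘁ` in Mathlib.
The functor `Cᵒᵖ × C → C`, `(U, V) ↦ U* ⊗ V`, `(f, g) ↦ f* ⊗ g`. -/
noncomputable def dualTensor : Cᵒᵖ ⥤ C ⥤ C where
  obj U := tensorLeft (U.unopᘁ)
  map f := (tensoringLeft C).map (f.unopᘁ)
  map_id U := by simp [rightAdjointMate_id]
  map_comp f g := by simp [comp_rightAdjointMate]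

/-- The coevaluation `1 → U ⊗ U*`. -/
noncomputable abbrev coev (U : C) : 𝟙_ C ⟶ U ⊗ Uᘁ := η_ U Uᘁ

/-- The dinatural family `ι_U : U* ⊗ U → L` of a cowedge. -/
noncomputable abbrev cowedgeι (c : Cowedge (dualTensor C)) (U : C) : Uᘁ ⊗ U ⟶ c.pt := c.π U

/-- The dinatural family
`U* ⊗ U → U* ⊗ (1 ⊗ U) → U* ⊗ ((U ⊗ U*) ⊗ U) → (U* ⊗ U) ⊗ (U* ⊗ U) → L ⊗ L`,
which inserts the coevaluation and then applies `ι_U ⊗ ι_U`. -/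
noncomputable def coendComulFamily (c : Cowedge (dualTensor C)) (U : C) :
    Uᘁ ⊗ U ⟶ c.pt ⊗ c.pt :=
  Uᘁ ◁ (λ_ U).inv ≫ Uᘁ ◁ (coev U ▷ U) ≫ Uᘁ ◁ (α_ U Uᘁ U).hom ≫ (α_ Uᘁ U (Uᘁ ⊗ U)).inv ≫
    (cowedgeι c U ⊗ₘ cowedgeι c U)

theorem cowedgeι_dinatural (c : Cowedge (dualTensor C)) {U V : C} (f : U ⟶ V) :
    fᘁ ▷ U ≫ cowedgeι c U = Vᘁ ◁ f ≫ cowedgeι c V := c.condition f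

/-- `X ⊗ U → X ⊗ (1 ⊗ U) → X ⊗ ((P ⊗ Q) ⊗ U) → X ⊗ (P ⊗ (Q ⊗ U)) → (X ⊗ P) ⊗ (Q ⊗ U)`,
inserting a morphism `s : 1 → P ⊗ Q`. -/
def insertMid (X U : C) {P Q : C} (s : 𝟙_ C ⟶ P ⊗ Q) : X ⊗ U ⟶ (X ⊗ P) ⊗ (Q ⊗ U) :=
  X ◁ (λ_ U).inv ≫ X ◁ (s ▷ U) ≫ X ◁ (α_ P Q U).hom ≫ (α_ X P (Q ⊗ U)).inv

theorem insertMid_right (X : C) {U V P Q : C} (s : 𝟙_ C ⟶ P ⊗ Q) (f : U ⟶ V) :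
    X ◁ f ≫ insertMid X V s = insertMid X U s ≫ (X ⊗ P) ◁ (Q ◁ f) := by
  simp only [insertMid, ← whiskerLeft_comp_assoc, Category.assoc]
  rw [leftUnitor_inv_naturality_assoc, whisker_exchange_assoc]
  simp

theorem insertMid_left {X Y : C} (U : C) {P Q : C} (s : 𝟙_ C ⟶ P ⊗ Q) (g : X ⟶ Y) :
    g ▷ U ≫ insertMid Y U s = insertMid X U s ≫ (g ▷ P) ▷ (Q ⊗ U) := by
  simp only [insertMid, Category.assoc]
  rw [← whisker_exchange_assoc, ← whisker_exchange_assoc, ← whisker_exchange_assoc]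
  simp

theorem insertMid_midRight (X U : C) {P Q Q' : C} (s : 𝟙_ C ⟶ P ⊗ Q) (g : Q ⟶ Q') :
    insertMid X U (s ≫ P ◁ g) = insertMid X U s ≫ (X ⊗ P) ◁ (g ▷ U) := by
  simp [insertMid]

theorem insertMid_midLeft (X U : C) {P P' Q : C} (s : 𝟙_ C ⟶ P ⊗ Q) (g : P ⟶ P') :
    insertMid X U (s ≫ g ▷ Q) = insertMid X U s ≫ (X ◁ g) ▷ (Q ⊗ U) := by
  simp [insertMid]

theorem coendComulFamily_eq (c : Cowedge (dualTensor C)) (U : C) :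
    coendComulFamily c U = insertMid Uᘁ U (coev U) ≫ (cowedgeι c U ⊗ₘ cowedgeι c U) := by
  simp [coendComulFamily, insertMid]

theorem coendComulFamily_dinatural (c : Cowedge (dualTensor C)) {U V : C} (f : U ⟶ V) :
    fᘁ ▷ U ≫ coendComulFamily c U = Vᘁ ◁ f ≫ coendComulFamily c V := by
  have e := cowedgeι_dinatural c f
  calc fᘁ ▷ U ≫ coendComulFamily c U
      = insertMid Vᘁ U (coev U) ≫ ((fᘁ ▷ U ≫ cowedgeι c U) ⊗ₘ cowedgeι c U) := by
        rw [coendComulFamily_eq, ← Category.assoc, insertMid_left, Category.assoc,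
          ← tensorHom_id, tensorHom_comp_tensorHom, Category.id_comp]
    _ = insertMid Vᘁ U (coev U ≫ f ▷ Uᘁ) ≫ (cowedgeι c V ⊗ₘ cowedgeι c U) := by
        rw [e, insertMid_midLeft, Category.assoc, ← tensorHom_id, tensorHom_comp_tensorHom,
          Category.id_comp]
    _ = insertMid Vᘁ U (coev V) ≫ (cowedgeι c V ⊗ₘ (fᘁ ▷ U ≫ cowedgeι c U)) := by
        rw [← coevaluation_comp_rightAdjointMate, insertMid_midRight, Category.assoc,
          ← id_tensorHom, tensorHom_comp_tensorHom, Category.id_comp]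
    _ = Vᘁ ◁ f ≫ coendComulFamily c V := by
        rw [e, coendComulFamily_eq, ← Category.assoc, insertMid_right, Category.assoc,
          ← id_tensorHom (Vᘁ ⊗ V), tensorHom_comp_tensorHom, Category.id_comp]

/-- The coproduct `L → L ⊗ L` of the coend `L = ∫ U* ⊗ U` (a universal cowedge `c`): the unique
morphism whose composite with each `ι_U` is `coendComulFamily c U`. -/
noncomputable def coendComul (c : Cowedge (dualTensor C)) (hc : IsColimit c) :
    c.pt ⟶ c.pt ⊗ c.pt :=
  Cowedge.IsColimit.desc hc (coendComulFamily c) fun _ _ f => coendComulFamily_dinatural c f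

theorem ι_coendComul (c : Cowedge (dualTensor C)) (hc : IsColimit c) (U : C) :
    cowedgeι c U ≫ coendComul c hc = coendComulFamily c U :=
  Cowedge.IsColimit.π_desc hc _ _ U

/-- The unit `1 → L` of the coend: `1 → 1 ⊗ 1* → 1* → 1* ⊗ 1 → L`. -/
noncomputable def coendUnit (c : Cowedge (dualTensor C)) : 𝟙_ C ⟶ c.pt :=
  coev (𝟙_ C) ≫ (λ_ _).hom ≫ (ρ_ _).inv ≫ cowedgeι c (𝟙_ C)

theorem mate_unique {X Y : C} (f : X ⟶ Y) (g : Yᘁ ⟶ Xᘁ)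
    (h : g ▷ X ≫ ε_ X Xᘁ = Yᘁ ◁ f ≫ ε_ Y Yᘁ) : g = fᘁ := by
  rw [← rightAdjointMate_comp_evaluation] at h
  have key : ∀ p : Yᘁ ⟶ Xᘁ,
      (tensorRightHomEquiv (Yᘁ) X (Xᘁ) (𝟙_ C)).symm (p ≫ (λ_ _).inv) = p ▷ X ≫ ε_ X Xᘁ := by
    intro p
    have h1 : (λ_ (𝟙_ C)).inv ≫ (ρ_ (𝟙_ C)).hom = 𝟙 _ := by
      rw [← unitors_equal, Iso.inv_hom_id]
    simp [tensorRightHomEquiv, h1]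
  rw [← key, ← key] at h
  simpa using h

end Coend

namespace FinRep
open QuasiHopfAlgebra

variable {k A : Type u} [Field k] [Ring A] [Algebra k A] [QuasiHopfAlgebra k A]

theorem transpose_comm {U V : Type u} [AddCommGroup U] [Module k U] [AddCommGroup V] [Module k V]
    (f : A →ₐ[k] Module.End k U) (g : A →ₐ[k] Module.End k V) (p : U →ₗ[k] V)
    (hp : ∀ a x, p (f a x) = g a (p x)) (a : A) (φ : Module.Dual k V) :
    Module.Dual.transpose (R := k) p (dualAct g a φ) =
      dualAct f a (Module.Dual.transpose (R := k) p φ) := by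
  ext x
  simp [Module.Dual.transpose_apply, dualAct_apply, hp]

/-- The transpose of `f : X → Y` as a morphism `Y* → X*`. -/
noncomputable def transpose {X Y : FinRep k A} (f : X ⟶ Y) : dual Y ⟶ dual X :=
  ⟨(Module.Dual.transpose (R := k) f.lin : Module.Dual k Y.V →ₗ[k] Module.Dual k X.V),
    fun a φ => transpose_comm X.ρ Y.ρ f.lin f.comm a φ⟩

theorem mate_eq_transpose {X Y : FinRep k A} (f : X ⟶ Y) : fᘁ = transpose f := by
  refine (mate_unique f (transpose f) ?_).symm
  apply hom_ext
  apply TensorProduct.ext'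
  intro φ x
  exact LinearMap.congr_arg (f := (show Module.Dual k Y.V from φ)) (f.comm _ x)

variable (k A) in
/-- `A → End(A*)`, `b.φ = (x ↦ φ(x b))`. -/
noncomputable def rightTranspose : A →ₐ[k] Module.End k (Module.Dual k A) :=
  AlgHom.ofLinearMap
    ((Module.Dual.transpose : Module.End k A →ₗ[k] _) ∘ₗ (LinearMap.mul k A).flip)
    (by ext φ x; simp [Module.Dual.transpose_apply])
    (by intro a b; ext φ x; simp [Module.Dual.transpose_apply, mul_assoc])

theorem rightTranspose_apply (b x : A) (φ : Module.Dual k A) :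
    rightTranspose k A b φ x = φ (x * b) := rfl

theorem coadj_commute (a b : A) :
    Commute (dualAct (Algebra.lmul k A) a) (rightTranspose k A b) := by
  refine LinearMap.ext fun φ => LinearMap.ext fun x => ?_
  simp [rightTranspose_apply, dualAct_apply, mul_assoc]

variable (k A) in
/-- The algebra map `A ⊗ A → End(A*)`, `(a ⊗ b).φ = (x ↦ φ(S(a) x b))`. -/
noncomputable def coadjPre : A ⊗[k] A →ₐ[k] Module.End k (Module.Dual k A) :=
  Algebra.TensorProduct.lift (dualAct (Algebra.lmul k A)) (rightTranspose k A) coadj_commute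

theorem coadjPre_tmul (a b x : A) (φ : Module.Dual k A) :
    coadjPre k A (a ⊗ₜ b) φ x = φ (antipode (k := k) a * x * b) := by
  rw [coadjPre, Algebra.TensorProduct.lift_tmul, Module.End.mul_apply, dualAct_apply,
    rightTranspose_apply]
  rfl

variable [FiniteDimensional k A]

variable (k A) in
/-- The coadjoint representation `A*`, `(a.φ)(x) = ∑ φ(S(a') x a'')`. -/
noncomputable def coadj : FinRep k A := ⟨Module.Dual k A, (coadjPre k A).comp comul⟩

variable (k A) in
/-- The regular representation. -/
noncomputable def regular : FinRep k A := ⟨A, Algebra.lmul k A⟩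

/-- The map `M* ⊗ M → A*`, `φ ⊗ m ↦ (a ↦ φ(a.m))`. -/
noncomputable def coadjιLin (M : FinRep k A) : Module.Dual k M.V ⊗[k] M.V →ₗ[k] Module.Dual k A :=
  TensorProduct.lift <| LinearMap.mk₂ k
    (fun (φ : Module.Dual k M.V) (m : M.V) => φ ∘ₗ M.ρ.toLinearMap.flip m)
    (by intros; ext; simp) (by intros; ext; simp) (by intros; ext; simp) (by intros; ext; simp)

theorem coadjιLin_tmul (M : FinRep k A) (φ : Module.Dual k M.V) (m : M.V) (a : A) :
    coadjιLin M (φ ⊗ₜ m) a = φ (M.ρ a m) := rfl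

theorem coadjιLin_act (M : FinRep k A) (x : A ⊗[k] A) (φ : Module.Dual k M.V) (m : M.V) :
    coadjιLin M (act (dualAct M.ρ) M.ρ x (φ ⊗ₜ m)) = coadjPre k A x (coadjιLin M (φ ⊗ₜ m)) := by
  induction x with
  | zero => simp
  | add x y hx hy => simp only [map_add, hx, hy, LinearMap.add_apply]
  | tmul a b =>
    ext y
    rw [coadjPre_tmul]
    simp [coadjιLin_tmul, dualAct_apply]

/-- The morphism `ι_M : M* ⊗ M → A*`. -/
noncomputable def coadjι (M : FinRep k A) : Mᘁ ⊗ M ⟶ coadj k A :=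
  ⟨coadjιLin M, fun a t => by
    have : ∀ t : Module.Dual k M.V ⊗[k] M.V,
      coadjιLin M (act (dualAct M.ρ) M.ρ (comul a) t) =
        coadjPre k A (comul a) (coadjιLin M t) := by
      intro t
      induction t with
      | zero => simp
      | add x y hx hy => simp only [map_add, hx, hy]
      | tmul φ m => exact coadjιLin_act M _ φ m
    exact this t⟩

theorem coadjι_dinatural {M N : FinRep k A} (f : M ⟶ N) :
    fᘁ ▷ M ≫ coadjι M = Nᘁ ◁ f ≫ coadjι N := by
  rw [mate_eq_transpose]
  apply hom_ext
  apply TensorProduct.ext'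
  intro φ m
  apply LinearMap.ext
  intro a
  exact LinearMap.congr_arg (f := (show Module.Dual k N.V from φ)) (f.comm a m)

variable (k A) in
/-- The dinatural family `(A*, ι)`. -/
noncomputable def coadjCowedge : Cowedge (dualTensor (FinRep k A)) :=
  Cowedge.mk (coadj k A) coadjι fun _ _ f => coadjι_dinatural f

/-- The action map `A → M`, `a ↦ a.m`, from the regular representation. -/
noncomputable def orbit (M : FinRep k A) (m : M.V) : regular k A ⟶ M :=
  ⟨M.ρ.toLinearMap.flip m, fun a x => by
    have : ∀ x : A, M.ρ (a * x) m = M.ρ a (M.ρ x m) := fun x => by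
      rw [map_mul, Module.End.mul_apply]
    exact this x⟩

theorem dinatural_lin (c : Cowedge (dualTensor (FinRep k A))) {M N : FinRep k A} (f : M ⟶ N)
    (φ : Module.Dual k N.V) (m : M.V) :
    (cowedgeι c M).lin (Module.Dual.transpose (R := k) f.lin φ ⊗ₜ[k] m) =
      (cowedgeι c N).lin (φ ⊗ₜ[k] f.lin m) := by
  have h := cowedgeι_dinatural c f
  rw [mate_eq_transpose] at h
  exact LinearMap.congr_fun (congrArg Hom.lin h) (φ ⊗ₜ[k] m)

theorem desc_comm_aux {W : Type*} [AddCommGroup W] [Module k W]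
    (P : Module.Dual k A ⊗[k] A →ₗ[k] W)
    (hP : ∀ (b : A) (φ : Module.Dual k A) (a : A),
      P (rightTranspose k A b φ ⊗ₜ a) = P (φ ⊗ₜ (a * b)))
    (x : A ⊗[k] A) (φ : Module.Dual k A) :
    P (coadjPre k A x φ ⊗ₜ[k] (1 : A)) =
      P (act (dualAct (Algebra.lmul k A)) (Algebra.lmul k A) x (φ ⊗ₜ[k] (1 : A))) := by
  induction x with
  | zero => simp
  | add x y hx hy => simp only [map_add, hx, hy, LinearMap.add_apply, TensorProduct.add_tmul]
  | tmul a b =>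
    have h1 : coadjPre k A (a ⊗ₜ b) φ =
        rightTranspose k A b (dualAct (Algebra.lmul k A) a φ) := by
      ext x
      rw [coadjPre_tmul]
      simp [rightTranspose_apply, dualAct_apply, mul_assoc]
    rw [h1, hP]
    simp

/-- The morphism `A* → W`, `φ ↦ κ_A(φ ⊗ 1)`, induced by a dinatural family `κ_M : M* ⊗ M → W`. -/
noncomputable def coadjDesc (c : Cowedge (dualTensor (FinRep k A))) : coadj k A ⟶ c.pt :=
  ⟨(cowedgeι c (regular k A)).lin ∘ₗ (TensorProduct.mk k (Module.Dual k A) A).flip 1, by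
    intro a φ
    refine (desc_comm_aux (k := k) (A := A) (W := c.pt.V) (cowedgeι c (regular k A)).lin (fun b φ a =>
      dinatural_lin c (orbit (regular k A) (b : A)) φ (a : A)) (comul a) φ).trans ?_
    exact (cowedgeι c (regular k A)).comm a _⟩

theorem coadjDesc_fac (c : Cowedge (dualTensor (FinRep k A))) (M : FinRep k A) :
    coadjι M ≫ coadjDesc c = cowedgeι c M := by
  apply hom_ext
  apply TensorProduct.ext'
  intro φ m
  refine (dinatural_lin c (orbit M m) φ (1 : A)).trans ?_
  have : (orbit M m).lin (1 : A) = m := by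
    change M.ρ 1 m = m
    simp
  rw [this]

theorem coadjDesc_uniq (c : Cowedge (dualTensor (FinRep k A))) (p : coadj k A ⟶ c.pt)
    (hp : coadjι (regular k A) ≫ p = cowedgeι c (regular k A)) : p = coadjDesc c := by
  apply hom_ext
  apply LinearMap.ext
  intro φ
  refine Eq.trans ?_ (LinearMap.congr_fun (congrArg Hom.lin hp)
    ((show Module.Dual k A from φ) ⊗ₜ[k] (1 : A)))
  have h2 : ∀ φ : Module.Dual k A, coadjιLin (regular k A) (φ ⊗ₜ (1 : A)) = φ := by
    intro φ
    apply LinearMap.ext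
    intro a
    have : ∀ a : A, φ (a * 1) = φ a := by simp
    exact this a
  exact congrArg p.lin (h2 φ).symm

variable (k A) in
/-- `(A*, ι)` is the coend of `(U, V) ↦ U* ⊗ V` on `Rep A`. -/
noncomputable def coadjIsColimit : IsColimit (coadjCowedge k A) :=
  Multicofork.IsColimit.mk _ coadjDesc (fun c M => coadjDesc_fac c M)
    (fun c p hp => coadjDesc_uniq c p (hp (regular k A)))


variable (k A) in
/-- The coend `L = ∫ U* ⊗ U = A*` in `Rep A`. -/
noncomputable abbrev coendL : FinRep k A := (coadjCowedge k A).pt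

variable (k A) in
/-- The coproduct `Δ_L : L → L ⊗ L`. -/
noncomputable def comulL : coendL k A ⟶ coendL k A ⊗ coendL k A :=
  coendComul (coadjCowedge k A) (coadjIsColimit k A)

variable (k A) in
/-- The unit `η_L : 1 → L`. -/
noncomputable def unitL : 𝟙_ (FinRep k A) ⟶ coendL k A :=
  coendUnit (coadjCowedge k A)

/-- A linear form `Λ` on the space of `L` is a left cointegral if `(id ⊗ Λ) ∘ Δ = e ∘ Λ`, as linear
maps `L → L`. -/
def IsLeftCointegralForm {L : FinRep k A} (Δ : L ⟶ L ⊗ L) (e : 𝟙_ (FinRep k A) ⟶ L)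
    (Λ : L.V →ₗ[k] k) : Prop :=
  ∀ x : L.V, TensorProduct.rid k L.V (TensorProduct.map LinearMap.id Λ (Δ.lin x)) = e.lin (Λ x)

/-- A linear form `Λ` on the space of `L` is a right cointegral if `(Λ ⊗ id) ∘ Δ = e ∘ Λ`, as linear
maps `L → L`. -/
def IsRightCointegralForm {L : FinRep k A} (Δ : L ⟶ L ⊗ L) (e : 𝟙_ (FinRep k A) ⟶ L)
    (Λ : L.V →ₗ[k] k) : Prop :=
  ∀ x : L.V, TensorProduct.lid k L.V (TensorProduct.map Λ LinearMap.id (Δ.lin x)) = e.lin (Λ x)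

end FinRep

/-- `c` is a left integral: `a c = ε(a) c` for all `a`. -/
def QuasiHopfAlgebra.IsLeftIntegral (k : Type*) {A : Type*} [Field k] [Ring A] [Algebra k A]
    [QuasiHopfAlgebra k A] (c : A) : Prop :=
  ∀ a : A, a * c = QuasiHopfAlgebra.counit (k := k) a • c

/-- `c` is a right integral: `c a = ε(a) c` for all `a`. -/
def QuasiHopfAlgebra.IsRightIntegral (k : Type*) {A : Type*} [Field k] [Ring A] [Algebra k A]
    [QuasiHopfAlgebra k A] (c : A) : Prop :=
  ∀ a : A, c * a = QuasiHopfAlgebra.counit (k := k) a • c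

section
variable {C : Type*} [Category* C] [MonoidalCategory C]
/-- A morphism `Λ : L → 1` is a left cointegral if `ϱ ∘ (id ⊗ Λ) ∘ Δ = e ∘ Λ`. -/
def IsLeftCointegral {L : C} (Δ : L ⟶ L ⊗ L) (e : 𝟙_ C ⟶ L) (Λ : L ⟶ 𝟙_ C) : Prop :=
  Δ ≫ L ◁ Λ ≫ (ρ_ L).hom = Λ ≫ e

/-- A morphism `Λ : L → 1` is a right cointegral if `λ ∘ (Λ ⊗ id) ∘ Δ = e ∘ Λ`. -/
def IsRightCointegral {L : C} (Δ : L ⟶ L ⊗ L) (e : 𝟙_ C ⟶ L) (Λ : L ⟶ 𝟙_ C) : Prop :=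
  Δ ≫ Λ ▷ L ≫ (λ_ L).hom = Λ ≫ e
end

/-! ### Counit, antipode and the element `alpha`. -/

namespace QuasiHopfAlgebra

variable {k A : Type*} [Field k] [Ring A] [Algebra k A] [QuasiHopfAlgebra k A]

/-! Write `Φ = ∑ p ⊗ q ⊗ r` and `Φ⁻¹ = ∑ z₁ ⊗ z₂ ⊗ z₃`. Since `f = ι_A(f ⊗ 1)`, the coproduct of the
coend can be read off from the regular representation alone (`comulL_lin`). The coevaluation of that
representation, viewed as an endomorphism of `A` through `toEnd`, is left multiplication by `β`.

Let `c` be a left integral. Evaluating the second factor of `Δ_L f` at `c` gives, as a function of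
`x`, the sum of `ε(z₂) f(S(p) x q z₁ β c r z₃)`: the coadjoint action of `r`, tested at `c`, is
right translation by `r`, and `S(z₂)` is absorbed by `c`. Everything to the left of `c` then turns
into its counit. What remains is `ε(β) ε(x) f(c · (ε ⊗ ε ⊗ id)(Φ) · (ε ⊗ ε ⊗ id)(Φ⁻¹))`, and both
elements in the argument are 1.

Let `c` be a right integral. Evaluating the first factor at `c` turns everything to the right of `c`
into its counit. This puts `ε` in front of the coevaluation, so the second factor becomes a multiple
of `ε`, which is invariant under the coadjoint action. The legs collapse to `ε(β) ε(y) f(S((id ⊗ ε ⊗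
ε)(Φ)) c)`, multiplied by the counit of `(id ⊗ ε ⊗ ε)(Φ⁻¹)`; again both elements are 1.

The unit of the coend is `ε(β) ε` (`unitL_lin`), so both results equal `η_L(f(c))`. Besides the
axioms this uses only `ε ∘ S = ε` and the two normalisations of `Φ`. Sweedler-type sums are treated
by replacing `Δ(a)`, `Φ` and `Φ⁻¹` by arbitrary tensors, reducing to pure tensors by linearity, and
invoking the axiom at the end. -/

theorem counit_antipode_mul_counit (x : A ⊗[k] A) :
    counit (LinearMap.mul' k A
      (TensorProduct.map (antipode (k := k)) (LinearMap.mulLeft k (alpha k)) x)) =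
      (counit (k := k) (antipode (k := k) (Algebra.TensorProduct.rid k k A
        (Algebra.TensorProduct.map (AlgHom.id k A) (counit (k := k)) x))) *
          counit (k := k) (alpha k : A) : k) := by
  induction x with
  | zero => simp
  | add x y hx hy => simp only [map_add, hx, hy, add_mul]
  | tmul a b => simp; ring

/-- Every term of the zigzag sum contains the factor `α`. If `ε(α)` vanished, the multiplicative map
`ε` would send this sum, which is 1, to 0. -/
theorem counit_alpha_ne_zero : counit (k := k) (alpha k : A) ≠ 0 := by
  intro h
  have key : ∀ x : A ⊗[k] (A ⊗[k] A), counit (k := k) (LinearMap.mul' k A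
      (TensorProduct.map (antipode (k := k))
        (LinearMap.mul' k A ∘ₗ TensorProduct.map (LinearMap.mulLeft k (alpha k))
            (LinearMap.mulLeft k (beta k) ∘ₗ antipode (k := k))) x)) = 0 := by
    intro x
    induction x with
    | zero => simp
    | add x y hx hy => simp only [map_add, hx, hy, add_zero]
    | tmul a x =>
      induction x with
      | zero => simp
      | add x y hx hy => simp only [map_add, hx, hy, add_zero, TensorProduct.tmul_add]
      | tmul b c => simp [h]
  have h1 := key (FinRep.Phi k A)
  rw [zigzag, map_one] at h1
  exact one_ne_zero h1

/-- Applying `ε` to `∑ S(a') α a'' = ε(a) α` gives `ε(S(a)) ε(α) = ε(a) ε(α)`, and `ε(α)` can be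
cancelled. -/
theorem counit_antipode (a : A) : counit (k := k) (antipode (k := k) a) = counit (k := k) a := by
  have h := counit_antipode_mul_counit (k := k) (comul a)
  rw [antipode_alpha, comul_counit, map_smul, smul_eq_mul] at h
  exact (mul_right_cancel₀ counit_alpha_ne_zero h).symm

/-! ### Normalisation of the coassociator under two counits. -/

variable (k A) in
/-- The map `ε ⊗ ε ⊗ id`. -/
noncomputable def counitLeft : A ⊗[k] (A ⊗[k] A) →ₐ[k] A :=
  (Algebra.TensorProduct.lid k A).toAlgHom.comp
    (Algebra.TensorProduct.map counit ((Algebra.TensorProduct.lid k A).toAlgHom.comp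
      (Algebra.TensorProduct.map counit (AlgHom.id k A))))

variable (k A) in
/-- The map `id ⊗ ε ⊗ ε`. -/
noncomputable def counitRight : A ⊗[k] (A ⊗[k] A) →ₐ[k] A :=
  (Algebra.TensorProduct.rid k k A).toAlgHom.comp
    (Algebra.TensorProduct.map (AlgHom.id k A) ((counit (k := k)).comp
      ((Algebra.TensorProduct.lid k A).toAlgHom.comp
        (Algebra.TensorProduct.map counit (AlgHom.id k A)))))

@[simp] theorem counitLeft_tmul (a b c : A) :
    counitLeft k A (a ⊗ₜ (b ⊗ₜ c)) = counit (k := k) a • counit (k := k) b • c := by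
  simp [counitLeft, smul_smul, mul_comm]

@[simp] theorem counitRight_tmul (a b c : A) :
    counitRight k A (a ⊗ₜ (b ⊗ₜ c)) = (counit (k := k) b * counit (k := k) c) • a := by
  simp [counitRight]

/-- The map factors through `id ⊗ ε ⊗ id`, which already sends `Φ` to 1. The axiom for the middle
leg thus suffices, here and for `counitRight_Phi`. -/
theorem counitLeft_Phi : counitLeft k A (FinRep.Phi k A) = 1 := by
  have h : counitLeft k A = ((Algebra.TensorProduct.lid k A).toAlgHom.comp
      (Algebra.TensorProduct.map counit (AlgHom.id k A))).comp
      (Algebra.TensorProduct.map (AlgHom.id k A)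
        ((Algebra.TensorProduct.lid k A).toAlgHom.comp
          (Algebra.TensorProduct.map counit (AlgHom.id k A)))) := by
    ext <;> simp [counitLeft]
  rw [h, AlgHom.comp_apply, coassociator_counital, map_one]

theorem counitRight_Phi : counitRight k A (FinRep.Phi k A) = 1 := by
  have h : counitRight k A = ((Algebra.TensorProduct.rid k k A).toAlgHom.comp
      (Algebra.TensorProduct.map (AlgHom.id k A) counit)).comp
      (Algebra.TensorProduct.map (AlgHom.id k A)
        ((Algebra.TensorProduct.lid k A).toAlgHom.comp
          (Algebra.TensorProduct.map counit (AlgHom.id k A)))) := by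
    ext <;> simp [counitRight]
  rw [h, AlgHom.comp_apply, coassociator_counital, map_one]

theorem map_PhiInv_eq_one {B : Type*} [Ring B] [Algebra k B] (g : A ⊗[k] (A ⊗[k] A) →ₐ[k] B)
    (h : g (FinRep.Phi k A) = 1) : g (FinRep.PhiInv k A) = 1 := by
  have h1 : g (FinRep.PhiInv k A * FinRep.Phi k A) = 1 := by simp
  rwa [map_mul, h, mul_one] at h1

theorem counitLeft_PhiInv : counitLeft k A (FinRep.PhiInv k A) = 1 :=
  map_PhiInv_eq_one _ counitLeft_Phi

theorem counitRight_PhiInv : counitRight k A (FinRep.PhiInv k A) = 1 :=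
  map_PhiInv_eq_one _ counitRight_Phi

end QuasiHopfAlgebra

/-! ### The coadjoint action at an integral and on the counit. -/

namespace FinRep
open QuasiHopfAlgebra

variable {k A : Type u} [Field k] [Ring A] [Algebra k A] [QuasiHopfAlgebra k A]

/-- In `∑ g(S(a') c a'')` the integral absorbs `S(a')` as `ε(a')`, and counitality sums the rest to
`g(c a)`. -/
theorem coadjPre_comul_apply_of_isLeftIntegral {c : A} (hc : IsLeftIntegral k c) (a : A)
    (g : Module.Dual k A) : coadjPre k A (comul a) g c = g (c * a) := by
  have key : ∀ x : A ⊗[k] A, coadjPre k A x g c =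
      g (c * Algebra.TensorProduct.lid k A
        (Algebra.TensorProduct.map counit (AlgHom.id k A) x)) := by
    intro x
    induction x with
    | zero => simp
    | add x y hx hy => simp only [map_add, hx, hy, LinearMap.add_apply, mul_add]
    | tmul a b => rw [coadjPre_tmul, hc, counit_antipode]; simp
  rw [key, counit_comul]

/-- Multiplicativity of `ε` and `ε ∘ S = ε` make `ε` an invariant vector of `L`. In the
right-integral case this removes the action of the last leg of `Φ`. -/
theorem coadjPre_comul_counit (a : A) :
    coadjPre k A (comul a) (counit (k := k) (A := A)).toLinearMap =
      counit (k := k) a • (counit (k := k) (A := A)).toLinearMap := by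
  have key : ∀ x : A ⊗[k] A, coadjPre k A x (counit (k := k) (A := A)).toLinearMap =
      counit (k := k) (Algebra.TensorProduct.lid k A
        (Algebra.TensorProduct.map counit (AlgHom.id k A) x)) •
        (counit (k := k) (A := A)).toLinearMap := by
    intro x
    induction x with
    | zero => simp
    | add x y hx hy => simp only [map_add, hx, hy, LinearMap.add_apply, add_smul]
    | tmul a b =>
      ext y
      rw [coadjPre_tmul]
      simp [counit_antipode]
      ring
  rw [key, counit_comul]

variable [FiniteDimensional k A]

/-! ### The coproduct of the coend, computed on the regular representation. -/

variable (k A) in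
/-- The map `ι_A` of the regular representation. -/
noncomputable abbrev regularι : Module.Dual k A ⊗[k] A →ₗ[k] Module.Dual k A :=
  coadjιLin (regular k A)

theorem regularι_tmul (φ : Module.Dual k A) (u a : A) : regularι k A (φ ⊗ₜ u) a = φ (a * u) :=
  rfl

theorem regularι_tensAct (a : A) (t : Module.Dual k A ⊗[k] A) :
    regularι k A (tensAct (dualAct (Algebra.lmul k A)) (Algebra.lmul k A) a t) =
      coadjPre k A (comul a) (regularι k A t) :=
  (coadjι (regular k A)).comm a t

variable (k A) in
/-- `s ⊗ 1` in `A ⊗ (A* ⊗ A)` after the action of `z`, then inserted behind `f` and acted upon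
by `w`, with both pairs of adjacent factors mapped to `A*`. -/
noncomputable def comulForm (w z : A ⊗[k] (A ⊗[k] A)) (f : Module.Dual k A)
    (s : A ⊗[k] Module.Dual k A) : Module.Dual k A ⊗[k] Module.Dual k A :=
  TensorProduct.map (regularι k A) (regularι k A) ((TensorProduct.assoc k _ _ _).symm
    (act (dualAct (Algebra.lmul k A)) (act (Algebra.lmul k A)
      (tensAct (dualAct (Algebra.lmul k A)) (Algebra.lmul k A))) w
      (f ⊗ₜ act (Algebra.lmul k A) (act (dualAct (Algebra.lmul k A)) (Algebra.lmul k A)) z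
        (TensorProduct.assoc k _ _ _ (s ⊗ₜ (1 : A))))))

/-- The universal property is used only at the regular representation and at the vector `f ⊗ 1`,
which `ι_A` sends to `f`. The inner rebracketing runs against the direction of `Φ` and so
contributes `Φ⁻¹`; the outer one contributes `Φ`. -/
theorem comulL_lin (f : Module.Dual k A) :
    (comulL k A).lin f = comulForm k A (Phi k A) (PhiInv k A) f (coevLin (Algebra.lmul k A) 1) := by
  have h := LinearMap.congr_fun (congrArg Hom.lin
    (ι_coendComul (coadjCowedge k A) (coadjIsColimit k A) (regular k A)))
    ((f ⊗ₜ[k] (1 : A) : Module.Dual k A ⊗[k] A))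
  have h1 : regularι k A (f ⊗ₜ (1 : A)) = f := by
    ext a
    rw [regularι_tmul, mul_one]
  -- The chain of whiskerings and associators in `coendComulFamily` unfolds definitionally to
  -- `comulForm`.
  have h2 : (comulL k A).lin (regularι k A (f ⊗ₜ (1 : A))) =
    comulForm k A (Phi k A) (PhiInv k A) f (coevLin (Algebra.lmul k A) 1) := h
  rwa [h1] at h2

/-- The leg `r` acts on `A* ⊗ A` through `Δ(r)`. Equivariance of `ι_A` moves it outside as a
coadjoint action, where the lemmas on integrals and on `ε` apply. -/
theorem comulForm_tmul (p q r z₁ z₂ z₃ v : A) (f φ : Module.Dual k A) :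
    comulForm k A (p ⊗ₜ (q ⊗ₜ r)) (z₁ ⊗ₜ (z₂ ⊗ₜ z₃)) f (v ⊗ₜ φ) =
      regularι k A (dualAct (Algebra.lmul k A) p f ⊗ₜ (q * (z₁ * v))) ⊗ₜ
        coadjPre k A (comul r)
          (regularι k A (dualAct (Algebra.lmul k A) z₂ φ ⊗ₜ (z₃ * 1))) := by
  rw [← regularι_tensAct]
  rfl

section Additivity

variable (w w' z z' : A ⊗[k] (A ⊗[k] A)) (f : Module.Dual k A) (s s' : A ⊗[k] Module.Dual k A)

@[simp] theorem comulForm_zero_left : comulForm k A 0 z f s = 0 := by simp [comulForm]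

@[simp] theorem comulForm_zero_mid : comulForm k A w 0 f s = 0 := by simp [comulForm]

@[simp] theorem comulForm_zero_right : comulForm k A w z f 0 = 0 := by simp [comulForm]

theorem comulForm_add_left :
    comulForm k A (w + w') z f s = comulForm k A w z f s + comulForm k A w' z f s := by
  simp only [comulForm, map_add, LinearMap.add_apply]

theorem comulForm_add_mid :
    comulForm k A w (z + z') f s = comulForm k A w z f s + comulForm k A w z' f s := by
  simp only [comulForm, map_add, LinearMap.add_apply, TensorProduct.tmul_add]

theorem comulForm_add_right :
    comulForm k A w z f (s + s') = comulForm k A w z f s + comulForm k A w z f s' := by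
  simp only [comulForm, map_add, TensorProduct.tmul_add, TensorProduct.add_tmul]

end Additivity

/-! ### Contracting the coproduct with an integral. -/

theorem rid_comulForm_tmul {c : A} (hc : IsLeftIntegral k c) (p q r z₁ z₂ z₃ x : A)
    (f : Module.Dual k A) (s : A ⊗[k] Module.Dual k A) :
    TensorProduct.rid k (Module.Dual k A) (TensorProduct.map LinearMap.id (Module.Dual.eval k A c)
      (comulForm k A (p ⊗ₜ (q ⊗ₜ r)) (z₁ ⊗ₜ (z₂ ⊗ₜ z₃)) f s)) x =
      counit (k := k) z₂ •
        f (antipode (k := k) p * (x * (q * (z₁ * toEnd s (c * (r * z₃)))))) := by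
  induction s with
  | zero => simp
  | add s t hs ht => simp only [comulForm_add_right, map_add, LinearMap.add_apply, hs, ht, mul_add,
      smul_add]
  | tmul v φ =>
    rw [comulForm_tmul, TensorProduct.map_tmul, TensorProduct.rid_tmul, LinearMap.smul_apply,
      Module.Dual.eval_apply, coadjPre_comul_apply_of_isLeftIntegral hc, regularι_tmul,
      LinearMap.id_apply, regularι_tmul, dualAct_apply, dualAct_apply, toEnd_tmul]
    simp only [Algebra.coe_lmul_eq_mul, LinearMap.mul_apply', mul_one, Algebra.mul_smul_comm,
      map_smul, smul_eq_mul]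
    -- Isolates the product `S(z₂) c`, which the left integral reduces to `ε(z₂) c`.
    rw [mul_assoc c r z₃, ← mul_assoc _ c, hc, counit_antipode]
    simp only [Algebra.smul_mul_assoc, map_smul, smul_eq_mul]
    ring

/-- For `s = v ⊗ φ` the first factor gives `f(S(p) c q z₁ v)`, and `c` absorbs all that follows it.
The scalar `ε(v)` joins `φ` to form `ε ∘ toEnd s`; the factor `S(p)`, on the wrong side of `c`,
stays. -/
theorem lid_comulForm_tmul {c : A} (hc : IsRightIntegral k c) (p q r z₁ z₂ z₃ y : A)
    (f : Module.Dual k A) (s : A ⊗[k] Module.Dual k A) :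
    TensorProduct.lid k (Module.Dual k A) (TensorProduct.map (Module.Dual.eval k A c) LinearMap.id
      (comulForm k A (p ⊗ₜ (q ⊗ₜ r)) (z₁ ⊗ₜ (z₂ ⊗ₜ z₃)) f s)) y =
      (counit (k := k) q * counit (k := k) z₁ * f (antipode (k := k) p * c)) •
        coadjPre k A (comul r) (regularι k A (dualAct (Algebra.lmul k A) z₂
          ((counit (k := k) (A := A)).toLinearMap ∘ₗ toEnd s) ⊗ₜ z₃)) y := by
  induction s with
  | zero => simp
  | add s t hs ht => simp only [comulForm_add_right, map_add, LinearMap.add_apply, hs, ht,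
      LinearMap.comp_add, TensorProduct.add_tmul, smul_add]
  | tmul v φ =>
    have h : (counit (k := k) (A := A)).toLinearMap ∘ₗ toEnd (v ⊗ₜ φ) =
        counit (k := k) v • φ := by
      ext a
      simp [toEnd_tmul, mul_comm]
    rw [comulForm_tmul, TensorProduct.map_tmul, TensorProduct.lid_tmul, LinearMap.smul_apply,
      Module.Dual.eval_apply, regularι_tmul, dualAct_apply, h, hc]
    simp only [Algebra.coe_lmul_eq_mul, LinearMap.mul_apply', mul_one, map_smul, smul_eq_mul,
      map_mul, LinearMap.smul_apply, ← TensorProduct.smul_tmul', Algebra.mul_smul_comm,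
      LinearMap.id_apply]
    ring

/-- The legs surviving to the right of `c` are the third ones of `w` and `z`, all others being hit
by `ε`; hence `counitLeft`. -/
theorem rid_comulForm_coevLin {c : A} (hc : IsLeftIntegral k c) (w z : A ⊗[k] (A ⊗[k] A)) (x : A)
    (f : Module.Dual k A) :
    TensorProduct.rid k (Module.Dual k A) (TensorProduct.map LinearMap.id (Module.Dual.eval k A c)
      (comulForm k A w z f (coevLin (Algebra.lmul k A) 1))) x =
      (counit (k := k) (beta k : A) * counit (k := k) x) •
        f (c * (counitLeft k A w * counitLeft k A z)) := by
  induction w with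
  | zero => simp
  | add w w' hw hw' => simp only [comulForm_add_left, map_add, LinearMap.add_apply, hw, hw',
      mul_add, add_mul, smul_add]
  | tmul p w =>
    induction w with
    | zero => simp
    | add w w' hw hw' => simp only [comulForm_add_left, TensorProduct.tmul_add, map_add,
        LinearMap.add_apply, hw, hw', mul_add, add_mul, smul_add]
    | tmul q r =>
      induction z with
      | zero => simp
      | add w w' hw hw' => simp only [comulForm_add_mid, map_add, LinearMap.add_apply, hw, hw',
          mul_add, smul_add]
      | tmul z₁ z =>
        induction z with
        | zero => simp
        | add w w' hw hw' => simp only [comulForm_add_mid, TensorProduct.tmul_add, map_add,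
            LinearMap.add_apply, hw, hw', mul_add, smul_add]
        | tmul z₂ z₃ =>
          rw [rid_comulForm_tmul hc, toEnd_coevLin]
          -- Gathers everything left of `c` into one element, so that a single use of the integral
          -- property suffices.
          have h : antipode (k := k) p * (x * (q * (z₁ * (beta k * (c * (r * z₃)))))) =
              (antipode (k := k) p * x * q * z₁ * beta k) * c * (r * z₃) := by
            simp only [mul_assoc]
          simp only [one_smul, Algebra.coe_lmul_eq_mul, LinearMap.mul_apply']
          rw [h, hc]
          simp [counit_antipode]
          ring

/-- Only the first leg of `w` escapes the counit, under `S` and to the left of `c`; `z` contributes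
just a scalar. -/
theorem lid_comulForm_coevLin {c : A} (hc : IsRightIntegral k c) (w z : A ⊗[k] (A ⊗[k] A)) (y : A)
    (f : Module.Dual k A) :
    TensorProduct.lid k (Module.Dual k A) (TensorProduct.map (Module.Dual.eval k A c) LinearMap.id
      (comulForm k A w z f (coevLin (Algebra.lmul k A) 1))) y =
      (counit (k := k) (beta k : A) * counit (k := k) y * counit (k := k) (counitRight k A z)) •
        f (antipode (k := k) (counitRight k A w) * c) := by
  induction w with
  | zero => simp
  | add w w' hw hw' => simp only [comulForm_add_left, map_add, LinearMap.add_apply, hw, hw',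
      mul_add, add_mul, smul_add]
  | tmul p w =>
    induction w with
    | zero => simp
    | add w w' hw hw' => simp only [comulForm_add_left, TensorProduct.tmul_add, map_add,
        LinearMap.add_apply, hw, hw', mul_add, add_mul, smul_add]
    | tmul q r =>
      induction z with
      | zero => simp
      | add w w' hw hw' => simp only [comulForm_add_mid, map_add, LinearMap.add_apply, hw, hw',
          mul_add, add_smul]
      | tmul z₁ z =>
        induction z with
        | zero => simp
        | add w w' hw hw' => simp only [comulForm_add_mid, TensorProduct.tmul_add, map_add,
            LinearMap.add_apply, hw, hw', mul_add, add_smul]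
        | tmul z₂ z₃ =>
          -- For the coevaluation, `ε ∘ toEnd s` is `a ↦ ε(β a)`, that is `ε(β) ε`; the actions of
          -- `z₂` and `z₃` only rescale it.
          have h : regularι k A (dualAct (Algebra.lmul k A) z₂
              ((counit (k := k) (A := A)).toLinearMap ∘ₗ
                toEnd (coevLin (Algebra.lmul k A) 1)) ⊗ₜ z₃) =
              (counit (k := k) (beta k : A) * counit (k := k) z₂ * counit (k := k) z₃) •
                (counit (k := k) (A := A)).toLinearMap := by
            ext a
            rw [toEnd_coevLin, regularι_tmul, dualAct_apply]
            simp [counit_antipode]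
            ring
          rw [lid_comulForm_tmul hc, h, map_smul, coadjPre_comul_counit]
          simp
          ring

/-! ### The unit of the coend and the cointegral equations. -/

/-- On the trivial representation `β` acts by `ε(β)`, and the matrix coefficients `ι_𝟙` are
multiples of `ε`. An endomorphism of `k` is its value at 1, which is why `toEnd s 1` is the scalar
in `key`. -/
theorem unitL_lin (t : k) : (unitL k A).lin t =
    (t * counit (k := k) (beta k : A)) • (counit (k := k) (A := A)).toLinearMap := by
  have key : ∀ s : k ⊗[k] Module.Dual k k,
      coadjιLin (𝟙_ (FinRep k A)) ((TensorProduct.rid k (Module.Dual k k)).symm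
        (TensorProduct.lid k (Module.Dual k k) s)) =
      toEnd s 1 • (counit (k := k) (A := A)).toLinearMap := by
    intro s
    induction s with
    | zero => simp
    | add s t hs ht => simp only [map_add, hs, ht, LinearMap.add_apply, add_smul]
    | tmul r φ =>
      refine LinearMap.ext fun a => ?_
      have h : (r • φ) (counit (k := k) a • (1 : k)) =
          (φ 1 • r) • counit (k := k) a := by
        rw [map_smul, LinearMap.smul_apply]
        simp only [smul_eq_mul]
        ring
      exact h
  have h := key (coevLin (unitAct (A := A)) t)
  rw [toEnd_coevLin] at h
  have h2 : (t • unitAct (k := k) (beta k : A)) (1 : k) =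
      t * counit (k := k) (beta k : A) := by
    simp
  rw [h2] at h
  exact h

theorem isLeftCointegralForm_eval {c : A} (hc : IsLeftIntegral k c) :
    IsLeftCointegralForm (comulL k A) (unitL k A) (Module.Dual.eval k A c) := by
  intro f
  change Module.Dual k A at f
  refine LinearMap.ext fun x => ?_
  have h := rid_comulForm_coevLin hc (Phi k A) (PhiInv k A) x f
  rw [← comulL_lin, counitLeft_Phi, counitLeft_PhiInv, mul_one, mul_one] at h
  refine h.trans (Eq.trans ?_ (LinearMap.congr_fun (unitL_lin (f c)) x).symm)
  rw [LinearMap.smul_apply, AlgHom.toLinearMap_apply]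
  simp only [smul_eq_mul]
  ring

theorem isRightCointegralForm_eval {c : A} (hc : IsRightIntegral k c) :
    IsRightCointegralForm (comulL k A) (unitL k A) (Module.Dual.eval k A c) := by
  intro f
  change Module.Dual k A at f
  refine LinearMap.ext fun x => ?_
  have h := lid_comulForm_coevLin hc (Phi k A) (PhiInv k A) x f
  rw [← comulL_lin, counitRight_Phi, counitRight_PhiInv, map_one, mul_one, antipode_one,
    one_mul] at h
  refine h.trans (Eq.trans ?_ (LinearMap.congr_fun (unitL_lin (f c)) x).symm)
  rw [LinearMap.smul_apply, AlgHom.toLinearMap_apply]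
  simp only [smul_eq_mul]
  ring

/-- The evaluation at a two-sided integral as a morphism `L → 1`. -/
noncomputable def evalIntegral {c : A} (hl : IsLeftIntegral k c) (hr : IsRightIntegral k c) :
    coendL k A ⟶ 𝟙_ (FinRep k A) :=
  ⟨Module.Dual.eval k A c, fun a f => by
    have h : ∀ f : Module.Dual k A, coadjPre k A (comul a) f c = counit (k := k) a • f c :=
      -- The left integral property reduces the action to `f(c a)`; the right one turns this into
      -- `ε(a) f(c)`.
      fun f => by rw [coadjPre_comul_apply_of_isLeftIntegral hl, hr, map_smul]
    exact h f⟩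

end FinRep

theorem proposition6p9 {k A : Type u} [Field k] [Ring A] [Algebra k A] [FiniteDimensional k A]
    [QuasiHopfAlgebra k A] (c : A) :
    (QuasiHopfAlgebra.IsLeftIntegral k c →
      FinRep.IsLeftCointegralForm (FinRep.comulL k A) (FinRep.unitL k A)
        (Module.Dual.eval k A c)) ∧
    (QuasiHopfAlgebra.IsRightIntegral k c →
      FinRep.IsRightCointegralForm (FinRep.comulL k A) (FinRep.unitL k A)
        (Module.Dual.eval k A c)) ∧
    (QuasiHopfAlgebra.IsLeftIntegral k c → QuasiHopfAlgebra.IsRightIntegral k c →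
      ∃ Λ : FinRep.coendL k A ⟶ 𝟙_ (FinRep k A), Λ.lin = Module.Dual.eval k A c ∧
        IsLeftCointegral (FinRep.comulL k A) (FinRep.unitL k A) Λ ∧
        IsRightCointegral (FinRep.comulL k A) (FinRep.unitL k A) Λ) :=
  ⟨FinRep.isLeftCointegralForm_eval, FinRep.isRightCointegralForm_eval, fun hl hr =>
    ⟨FinRep.evalIntegral hl hr, rfl,
      -- Morphisms agree once their linear maps do, and evaluated at `f` the categorical equation is
      -- definitionally the one for forms.
      FinRep.hom_ext (LinearMap.ext fun f => FinRep.isLeftCointegralForm_eval hl f),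
      FinRep.hom_ext (LinearMap.ext fun f => FinRep.isRightCointegralForm_eval hr f)⟩⟩
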